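/- All (co)homology is with $\mathbb{Z}_2$-coefficients, and $D(U)$ denotes the set of finitely supported probability distributions on a set $U$; $\delta^u$ is the delta distribution at $u$. The Mermin torus $T$ is the $2$-dimensional simplicial set obtained from six triangles, labelled by the three rows and the three columns of a $3\times 3$ square, by gluing them along nine edges $x_{ij}$ labelled by the cells $(i,j)\in(\mathbb{Z}/3)^2$: the face $d_k$ ($k=0,1,2$) of the triangle of a row or column is the edge of its unique cell $(i,j)$ with $i+j\equiv k \pmod 3$. Thus every edge lies on exactly two triangles, $T$ has three vertices, and its realization is a torus. Let $\beta:T_2\to\mathbb{Z}_2$ be a normalized $2$-cocycle with class $[\beta]\in H^2(T)\cong\mathbb{Z}_2$. The twisted product $\pi:N\mathbb{Z}_2\times_\beta T\to T$ is the principal bundle with $n$-simplices $\mathbb{Z}_2^n\times T_n$ and faces of $2$-simplices $d_0((a,b),\sigma)=(b+\beta(\sigma),d_0\sigma)$, $d_1((a,b),\sigma)=(a+b,d_1\sigma)$, $d_2((a,b),\sigma)=(a,d_2\sigma)$. Let $\mathrm{sDist}_\beta(T)$ be the polytope of $\beta$-twisted distributions, i.e. of simplicial maps $p:T\to D(N\mathbb{Z}_2\times_\beta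 T)$ with $D(\pi)\circ p=\delta$. Such a $p$ is deterministic if it is $\delta^s$ for a section $s$ of $\pi$. For $p\in\mathrm{sDist}_\beta(T)$ let $Z_p\subset T$ be the simplicial subset generated by the non-degenerate edges and triangles $x$ for which $p_x$ is a delta distribution. 1. If $[\beta]=0$, then $p\in \mathrm{sDist}_\beta(T)$ is a vertex if and only if it is deterministic. 2. If $[\beta]=1$ (that is, $[\beta]\neq 0$), then $p\in \mathrm{sDist}_\beta(T)$ is a vertex if and only if $Z_p$ is of one of the following two kinds: (a) $Z_p$ is generated by three non-degenerate edges such that each of the six triangles has exactly one of them in its boundary; (b) $Z_p$ is generated by two distinct non-degenerate triangles that have a common edge. Moreover, if $[\beta]=1$, both kinds occur with arbitrary outcomes: for every simplicial subset $Z\subset T$ of kind (a) or (b) and every function $s:Z_1\to\mathbb{Z}_2$ with $s(d_0\sigma)+s(d_1\sigma)+s(d_2\sigma)=\beta(\sigma)$ for all $\sigma\in Z_2$, there is exactly one vertex $p$ of $\mathrm{sDist}_\beta(T)$ with $Z_p=Z$ and $p_x=\delta^{s(x)}$ for all $x\in Z_1$. -/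

import Mathlib

namespace SimplicialDistribution

open CategoryTheory Simplicial Opposite Convexity

/-! ### Distributions -/

/-- The functor `U ↦ D(U)`: finitely supported probability distributions and push-forward. -/
noncomputable def distFunctor : Type ⥤ Type where
  obj U := StdSimplex ℝ U
  map f := TypeCat.ofHom (StdSimplex.map f)
  map_id U := by
    refine ConcreteCategory.hom_ext _ _ fun p => ?_
    exact StdSimplex.map_id p
  map_comp f g := by
    refine ConcreteCategory.hom_ext _ _ fun p => ?_
    exact StdSimplex.map_comp p f g

/-- The simplicial set `D(Y)`, with `D(Y)_n = D(Y_n)` and structure maps the push-forwards. -/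
noncomputable def distSSet (Y : SSet.{0}) : SSet.{0} :=
  ((SimplicialObject.whiskering _ _).obj distFunctor).obj Y

/-- `D(f) : D(Y) ⟶ D(Y')`, the levelwise push-forward. -/
noncomputable def distSSetMap {Y Y' : SSet.{0}} (f : Y ⟶ Y') : distSSet Y ⟶ distSSet Y' :=
  ((SimplicialObject.whiskering _ _).obj distFunctor).map f

/-- `δ : Y ⟶ D(Y)`, sending a simplex to the delta distribution peaked at it. -/
noncomputable def deltaMap (Y : SSet.{0}) : Y ⟶ distSSet Y where
  app n := TypeCat.ofHom fun y : Y.obj n => (StdSimplex.single y : StdSimplex ℝ (Y.obj n))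
  naturality m n f := by
    refine ConcreteCategory.hom_ext _ _ fun y => ?_
    exact (StdSimplex.map_single (R := ℝ) y (Y.map f)).symm

/-! ### Cohomology with coefficients in `ℤ/2` -/

/-- The coboundary `C^n(X) → C^{n+1}(X)` on functions `X_n → ℤ/2`. -/
def coboundary (X : SSet.{0}) (n : ℕ) :
    (X _⦋n⦌ → ZMod 2) →ₗ[ZMod 2] (X _⦋n + 1⦌ → ZMod 2) where
  toFun α x := ∑ i : Fin (n + 2), (-1) ^ (i : ℕ) * α (X.δ i x)
  map_add' α α' := by
    funext x
    simp [mul_add, Finset.sum_add_distrib]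
  map_smul' c α := by
    funext x
    simp only [Pi.smul_apply, smul_eq_mul, RingHom.id_apply, Finset.mul_sum]
    exact Finset.sum_congr rfl fun i _ => by ring

/-- `H²(X)`, the kernel of `C² → C³` modulo the image of `C¹ → C²`. -/
abbrev H2 (X : SSet.{0}) : Type :=
  LinearMap.ker (coboundary X 2) ⧸
    (LinearMap.range (coboundary X 1)).comap (LinearMap.ker (coboundary X 2)).subtype

/-- Normalized `2`-cocycles `β : X_2 → ℤ/2`. -/
structure NormalizedCocycle (X : SSet.{0}) where
  val : X _⦋2⦌ → ZMod 2
  cocycle : coboundary X 2 val = 0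
  normalized : ∀ x ∈ X.degenerate 2, val x = 0

/-- The class `[β] ∈ H²(X)`. -/
def NormalizedCocycle.cls {X : SSet.{0}} (β : NormalizedCocycle X) : H2 X :=
  Submodule.Quotient.mk ⟨β.val, LinearMap.mem_ker.mpr β.cocycle⟩

/-! ### The twisted product `Nℤ₂ ×_β X` -/

/-- The value of `β` on the `2`-dimensional face of `x` with vertices `i ≤ j ≤ k`. -/
def NormalizedCocycle.face {X : SSet.{0}} (β : NormalizedCocycle X) {n : SimplexCategory}
    (x : X.obj (op n)) (i j k : Fin (n.len + 1)) (hij : i ≤ j) (hjk : j ≤ k) : ZMod 2 :=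
  β.val (X.map (SimplexCategory.mkOfLeComp i j k hij hjk : ⦋2⦌ ⟶ n).op x)

theorem NormalizedCocycle.face_map {X : SSet.{0}} (β : NormalizedCocycle X)
    {m n : SimplexCategory} (θ : m ⟶ n) (x : X.obj (op n)) (i j k : Fin (m.len + 1))
    (hij : i ≤ j) (hjk : j ≤ k) :
    β.face (X.map θ.op x) i j k hij hjk =
      β.face x (θ.toOrderHom i) (θ.toOrderHom j) (θ.toOrderHom k)
        (θ.toOrderHom.monotone hij) (θ.toOrderHom.monotone hjk) := by
  unfold NormalizedCocycle.face
  have h : (SimplexCategory.mkOfLeComp i j k hij hjk : ⦋2⦌ ⟶ m) ≫ θ =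
      SimplexCategory.mkOfLeComp (θ.toOrderHom i) (θ.toOrderHom j) (θ.toOrderHom k)
        (θ.toOrderHom.monotone hij) (θ.toOrderHom.monotone hjk) := by
    ext t : 3
    fin_cases t <;> rfl
  rw [← h, op_comp, Functor.map_comp_apply]

theorem NormalizedCocycle.face_self {X : SSet.{0}} (β : NormalizedCocycle X)
    {n : SimplexCategory} (x : X.obj (op n)) (i j : Fin (n.len + 1)) (hij : i ≤ j) :
    β.face x i j j hij le_rfl = 0 := by
  apply β.normalized
  refine ⟨1, by norm_num, SimplexCategory.σ 1,
    X.map (SimplexCategory.mkOfLe i j hij : ⦋1⦌ ⟶ n).op x, ?_⟩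
  have h : SimplexCategory.σ 1 ≫ (SimplexCategory.mkOfLe i j hij : ⦋1⦌ ⟶ n) =
      SimplexCategory.mkOfLeComp i j j hij le_rfl := by
    ext t : 3
    fin_cases t <;> rfl
  rw [← Functor.map_comp_apply, ← op_comp, h]

theorem NormalizedCocycle.face_self_left {X : SSet.{0}} (β : NormalizedCocycle X)
    {n : SimplexCategory} (x : X.obj (op n)) (i j : Fin (n.len + 1)) (hij : i ≤ j) :
    β.face x i i j le_rfl hij = 0 := by
  apply β.normalized
  refine ⟨1, by norm_num, SimplexCategory.σ 0,
    X.map (SimplexCategory.mkOfLe i j hij : ⦋1⦌ ⟶ n).op x, ?_⟩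
  have h : SimplexCategory.σ 0 ≫ (SimplexCategory.mkOfLe i j hij : ⦋1⦌ ⟶ n) =
      SimplexCategory.mkOfLeComp i i j le_rfl hij := by
    ext t : 3
    fin_cases t <;> rfl
  rw [← Functor.map_comp_apply, ← op_comp, h]

theorem NormalizedCocycle.face_cocycle {X : SSet.{0}} (β : NormalizedCocycle X)
    {n : SimplexCategory} (x : X.obj (op n)) (i j k l : Fin (n.len + 1)) (hij : i ≤ j)
    (hjk : j ≤ k) (hkl : k ≤ l) :
    β.face x j k l hjk hkl = β.face x i k l (hij.trans hjk) hkl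
      - β.face x i j l hij (hjk.trans hkl) + β.face x i j k hij hjk := by
  let f : ⦋3⦌ ⟶ n := SimplexCategory.Hom.mk ⟨![i, j, k, l], by
    rw [Fin.monotone_iff_le_succ]
    intro t
    fin_cases t
    exacts [hij, hjk, hkl]⟩
  have key (t : Fin 4) (p q r : Fin (n.len + 1)) (hpq : p ≤ q) (hqr : q ≤ r)
      (h : SimplexCategory.δ t ≫ f = SimplexCategory.mkOfLeComp p q r hpq hqr) :
      β.val (X.δ t (X.map f.op x)) = β.face x p q r hpq hqr := by
    rw [NormalizedCocycle.face, ← h, op_comp, Functor.map_comp_apply]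
    rfl
  have hc : ∑ t : Fin 4, (-1) ^ (t : ℕ) * β.val (X.δ t (X.map f.op x)) = 0 :=
    congrFun β.cocycle (X.map f.op x)
  rw [Fin.sum_univ_four] at hc
  rw [key 0 j k l hjk hkl (by ext t : 3; fin_cases t <;> rfl),
    key 1 i k l (hij.trans hjk) hkl (by ext t : 3; fin_cases t <;> rfl),
    key 2 i j l hij (hjk.trans hkl) (by ext t : 3; fin_cases t <;> rfl),
    key 3 i j k hij hjk (by ext t : 3; fin_cases t <;> rfl)] at hc
  norm_num at hc
  have h2 : (2 : ZMod 2) = 0 := rfl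
  linear_combination hc - (β.face x i k l (hij.trans hjk) hkl + β.face x i j k hij hjk) * h2

/-- The `Nℤ₂`-coordinate of `θ^*(a, x)`, for `θ : [m] → [n]` and an `n`-simplex `(a, x)` of
`Nℤ₂ ×_β X`. The sum is the usual structure map of the nerve; the other two terms are the twist,
which is trivial unless `θ` moves the initial vertex. On the faces of a `2`-simplex this is
`d₀((a,b),σ) = (b + β(σ), d₀σ)`, `d₁((a,b),σ) = (a + b, d₁σ)`, `d₂((a,b),σ) = (a, d₂σ)`. -/
def twistAct {X : SSet.{0}} (β : NormalizedCocycle X) {m n : SimplexCategory} (θ : m ⟶ n)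
    (a : Fin n.len → ZMod 2) (x : X.obj (op n)) : Fin m.len → ZMod 2 := fun k =>
  (∑ j : Fin n.len, if θ.toOrderHom k.castSucc ≤ j.castSucc ∧ j.castSucc < θ.toOrderHom k.succ
      then a j else 0)
    + (β.face x 0 (θ.toOrderHom 0) (θ.toOrderHom k.succ) (Fin.zero_le _)
        (θ.toOrderHom.monotone (Fin.zero_le _))
    - β.face x 0 (θ.toOrderHom 0) (θ.toOrderHom k.castSucc) (Fin.zero_le _)
        (θ.toOrderHom.monotone (Fin.zero_le _)))

/-- The partial sums `a_1 + ⋯ + a_i`. -/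
def partialSum {N : ℕ} (a : Fin N → ZMod 2) (i : Fin (N + 1)) : ZMod 2 :=
  ∑ j : Fin N, if j.castSucc < i then a j else 0

theorem partialSum_zero {N : ℕ} (a : Fin N → ZMod 2) : partialSum a 0 = 0 := by
  simp [partialSum]

theorem partialSum_sub {N : ℕ} (a : Fin N → ZMod 2) (p q : Fin (N + 1)) (h : p ≤ q) :
    (∑ j : Fin N, if p ≤ j.castSucc ∧ j.castSucc < q then a j else 0) =
      partialSum a q - partialSum a p := by
  rw [partialSum, partialSum, ← Finset.sum_sub_distrib]
  refine Finset.sum_congr rfl fun j _ => ?_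
  by_cases h1 : j.castSucc < p
  · simp [h1, h1.trans_le h]
  · simp [h1, not_lt.mp h1]

theorem partialSum_succ {N : ℕ} (a : Fin N → ZMod 2) (j : Fin N) :
    partialSum a j.succ = partialSum a j.castSucc + a j := by
  have h := partialSum_sub a j.castSucc j.succ j.castSucc_lt_succ.le
  rw [Finset.sum_eq_single j] at h
  · rw [if_pos ⟨le_rfl, j.castSucc_lt_succ⟩] at h
    rw [h]; ring
  · intro i _ hi
    rw [if_neg]
    rintro ⟨h1, h2⟩
    apply hi
    simp only [Fin.le_def, Fin.lt_def, Fin.val_castSucc, Fin.val_succ] at h1 h2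
    ext; omega
  · simp

theorem partialSum_injective {N : ℕ} {a b : Fin N → ZMod 2}
    (h : ∀ i, partialSum a i = partialSum b i) : a = b := by
  funext j
  have := h j.succ
  rw [partialSum_succ, partialSum_succ, h] at this
  exact add_left_cancel this

theorem partialSum_twistAct {X : SSet.{0}} (β : NormalizedCocycle X) {m n : SimplexCategory}
    (θ : m ⟶ n) (a : Fin n.len → ZMod 2) (x : X.obj (op n)) (k : Fin (m.len + 1)) :
    partialSum (twistAct β θ a x) k =
      partialSum a (θ.toOrderHom k) - partialSum a (θ.toOrderHom 0)
        + β.face x 0 (θ.toOrderHom 0) (θ.toOrderHom k) (Fin.zero_le _)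
          (θ.toOrderHom.monotone (Fin.zero_le _)) := by
  induction k using Fin.induction with
  | zero => rw [partialSum_zero, β.face_self]; ring
  | succ k ih =>
    rw [partialSum_succ, ih, twistAct,
      partialSum_sub _ _ _ (θ.toOrderHom.monotone k.castSucc_lt_succ.le)]
    ring

/-- The twisted product `Nℤ₂ ×_β X`: its `n`-simplices are `ℤ₂ⁿ × X_n`. -/
def twistedProduct {X : SSet.{0}} (β : NormalizedCocycle X) : SSet.{0} where
  obj n := (Fin n.unop.len → ZMod 2) × X.obj n
  map {n m} θ := TypeCat.ofHom fun ax => (twistAct β θ.unop ax.1 ax.2, X.map θ ax.2)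
  map_id n := by
    refine ConcreteCategory.hom_ext _ _ fun ax => ?_
    refine Prod.ext (partialSum_injective fun k => ?_) ?_
    · refine (partialSum_twistAct β (𝟙 n.unop) ax.1 ax.2 k).trans ?_
      change partialSum ax.1 k - partialSum ax.1 0 + β.face ax.2 0 0 k _ _ = partialSum ax.1 k
      have h : β.face ax.2 0 0 k (Fin.zero_le _) (Fin.zero_le _) = 0 := β.face_self_left ax.2 0 k _
      rw [partialSum_zero, sub_zero]
      exact (congrArg (partialSum ax.1 k + ·) h).trans (add_zero _)
    · exact ConcreteCategory.congr_hom (X.map_id n) ax.2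
  map_comp {n m l} θ η := by
    refine ConcreteCategory.hom_ext _ _ fun ax => ?_
    refine Prod.ext (partialSum_injective fun k => ?_) ?_
    · refine (partialSum_twistAct β (η.unop ≫ θ.unop) ax.1 ax.2 k).trans ?_
      refine Eq.trans ?_
        (partialSum_twistAct β η.unop (twistAct β θ.unop ax.1 ax.2) (X.map θ ax.2) k).symm
      rw [partialSum_twistAct, partialSum_twistAct]
      have h1 := β.face_map θ.unop ax.2 0 (η.unop.toOrderHom 0) (η.unop.toOrderHom k)
        (Fin.zero_le _) (η.unop.toOrderHom.monotone (Fin.zero_le _))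
      have h2 := β.face_cocycle ax.2 0 (θ.unop.toOrderHom 0)
        (θ.unop.toOrderHom (η.unop.toOrderHom 0)) (θ.unop.toOrderHom (η.unop.toOrderHom k))
        (Fin.zero_le _) (θ.unop.toOrderHom.monotone (Fin.zero_le _))
        (θ.unop.toOrderHom.monotone (η.unop.toOrderHom.monotone (Fin.zero_le _)))
      rw [Quiver.Hom.op_unop] at h1
      rw [h1, h2]
      simp only [SimplexCategory.comp_toOrderHom, OrderHom.comp_coe, Function.comp_apply]
      ring
    · exact ConcreteCategory.congr_hom (X.map_comp θ η) ax.2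

/-- The projection `π : Nℤ₂ ×_β X ⟶ X`. -/
def twistedProj {X : SSet.{0}} (β : NormalizedCocycle X) : twistedProduct β ⟶ X where
  app n := TypeCat.ofHom fun ax : (Fin n.unop.len → ZMod 2) × X.obj n => ax.2
  naturality _ _ _ := rfl

/-! ### Twisted distributions -/

/-- `sDist_β(X)`: simplicial maps `p : X ⟶ D(Nℤ₂ ×_β X)` with `D(π) ∘ p = δ`. -/
def TwistedDist {X : SSet.{0}} (β : NormalizedCocycle X) : Type :=
  { p : X ⟶ distSSet (twistedProduct β) // p ≫ distSSetMap (twistedProj β) = deltaMap X }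

/-- The distribution `p_x` on `ℤ₂ⁿ × X_n` assigned to an `n`-simplex `x`. -/
noncomputable def TwistedDist.at {X : SSet.{0}} {β : NormalizedCocycle X} (p : TwistedDist β)
    {n : ℕ} (x : X _⦋n⦌) : StdSimplex ℝ ((Fin n → ZMod 2) × X _⦋n⦌) :=
  p.1.app (op ⦋n⦌) x

/-- `p_x = δ^a`. -/
def TwistedDist.IsDeltaAt {X : SSet.{0}} {β : NormalizedCocycle X} (p : TwistedDist β)
    {n : ℕ} (x : X _⦋n⦌) (a : Fin n → ZMod 2) : Prop :=
  p.at x = StdSimplex.single (a, x)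

/-- `p` is a deterministic distribution `δ^s`, for a section `s` of `π`. -/
def TwistedDist.IsDeterministic {X : SSet.{0}} {β : NormalizedCocycle X} (p : TwistedDist β) :
    Prop :=
  ∃ s : X ⟶ twistedProduct β, s ≫ twistedProj β = 𝟙 X ∧ p.1 = s ≫ deltaMap (twistedProduct β)

/-- All probabilities of `p`; this embeds `sDist_β(X)` as a convex set in a real vector space. -/
noncomputable def TwistedDist.coords {X : SSet.{0}} {β : NormalizedCocycle X}
    (p : TwistedDist β) : (n : ℕ) → X _⦋n⦌ → (Fin n → ZMod 2) × X _⦋n⦌ → ℝ :=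
  fun _ x ax => (p.at x).weights ax

/-- `p` is a vertex (extreme point) of `sDist_β(X)`. -/
def TwistedDist.IsVertex {X : SSet.{0}} {β : NormalizedCocycle X} (p : TwistedDist β) : Prop :=
  p.coords ∈ Set.extremePoints ℝ (Set.range (TwistedDist.coords (β := β)))

/-- `Z_p`: the simplicial subset generated by the deterministic edges and triangles, i.e. by the
non-degenerate `1`- and `2`-simplices `x` for which `p_x` is a delta distribution. -/
def TwistedDist.detSubset {X : SSet.{0}} {β : NormalizedCocycle X} (p : TwistedDist β) :
    X.Subcomplex :=
  (⨆ (x : X _⦋1⦌) (_ : x ∈ X.nonDegenerate 1 ∧ ∃ a, p.IsDeltaAt x a),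
      SSet.Subcomplex.ofSimplex x) ⊔
    ⨆ (x : X _⦋2⦌) (_ : x ∈ X.nonDegenerate 2 ∧ ∃ a, p.IsDeltaAt x a),
      SSet.Subcomplex.ofSimplex x

/-- `∂σ`, the set of edges in the boundary of a triangle. -/
def boundaryEdges {X : SSet.{0}} (σ : X _⦋2⦌) : Set (X _⦋1⦌) :=
  Set.range fun i : Fin 3 => X.δ i σ

/-- `Z` is generated by three non-degenerate edges such that every generating triangle of `X`
has exactly one of them in its boundary. -/
def IsThreeEdges {X : SSet.{0}} (Z : X.Subcomplex) : Prop :=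
  ∃ x : Fin 3 → X _⦋1⦌, Function.Injective x ∧ (∀ i, x i ∈ X.nonDegenerate 1) ∧
    (∀ σ ∈ X.nonDegenerate 2, ∃! i, x i ∈ boundaryEdges σ) ∧
    Z = ⨆ i, SSet.Subcomplex.ofSimplex (x i)

/-- `Z` is generated by two distinct non-degenerate triangles with a common non-degenerate edge. -/
def IsTwoTriangles {X : SSet.{0}} (Z : X.Subcomplex) : Prop :=
  ∃ σ ∈ X.nonDegenerate 2, ∃ τ ∈ X.nonDegenerate 2, σ ≠ τ ∧
    (∃ x ∈ X.nonDegenerate 1, x ∈ boundaryEdges σ ∧ x ∈ boundaryEdges τ) ∧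
    Z = SSet.Subcomplex.ofSimplex σ ⊔ SSet.Subcomplex.ofSimplex τ

/-! ### The Mermin torus -/

/-- The six triangles: the rows `inl i` and the columns `inr j` of the `3 × 3` Mermin square. -/
abbrev MerminTriangle : Type := Fin 3 ⊕ Fin 3

/-- The face `d_k` of a triangle, as a cell of the square: `d_k` of a row (column) is its cell
`(i, j)` with `i + j = k` modulo `3`. -/
def merminFace (σ : MerminTriangle) (k : Fin 3) : Fin 3 × Fin 3 :=
  Sum.elim (fun i => (i, k - i)) (fun j => (k - j, j)) σ

/-- The gluing of six copies of `Δ²`. An `n`-simplex of the copy labelled `σ` is a monotone map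
`α : [n] → [2]`. Simplices of the copies `σ` and `τ` are identified when they are equal as
simplices of `Δ²` and lie in faces `d_k` of `σ` and `τ` which are the same cell of the square
(in particular all vertices number `v` of the six triangles become one vertex). -/
def merminSetoid (n : ℕ) : Setoid (MerminTriangle × (Fin (n + 1) →o Fin 3)) where
  r a b := a.2 = b.2 ∧ (a.1 = b.1 ∨
    (∃ k, (∀ t, a.2 t ≠ k) ∧ merminFace a.1 k = merminFace b.1 k) ∨ ∃ v, ∀ t, a.2 t = v)
  iseqv := by
    refine ⟨fun a => ⟨rfl, .inl rfl⟩, ?_, ?_⟩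
    · rintro ⟨σ, α⟩ ⟨τ, α'⟩ ⟨rfl : α = α', h⟩
      refine ⟨rfl, ?_⟩
      rcases h with h | ⟨k, hk, h⟩ | h
      · exact .inl h.symm
      · exact .inr (.inl ⟨k, hk, h.symm⟩)
      · exact .inr (.inr h)
    · rintro ⟨σ, α⟩ ⟨τ, α'⟩ ⟨ρ, α''⟩ ⟨rfl : α = α', h⟩ ⟨rfl : α = α'', h'⟩
      refine ⟨rfl, ?_⟩
      rcases h with h | ⟨k, hk, h⟩ | h
      · obtain rfl : σ = τ := h
        exact h'
      · rcases h' with h' | ⟨l, hl, h'⟩ | h'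
        · obtain rfl : τ = ρ := h'
          exact .inr (.inl ⟨k, hk, h⟩)
        · by_cases hkl : k = l
          · subst hkl
            exact .inr (.inl ⟨k, hk, h.trans h'⟩)
          · refine .inr (.inr ⟨-(k + l), fun t => ?_⟩)
            exact (by decide : ∀ k l u : Fin 3, k ≠ l → u ≠ k → u ≠ l → u = -(k + l))
              k l (α t) hkl (hk t) (hl t)
        · exact .inr (.inr h')
      · exact .inr (.inr h)

/-- The Mermin torus: six triangles, one for each row and column of a `3 × 3` square, glued along
nine edges, one for each cell, so that an edge lies on its row triangle and its column triangle.
There are three vertices and each edge points from the lower to the higher numbered vertex. -/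
def merminTorus : SSet.{0} where
  obj n := Quotient (merminSetoid n.unop.len)
  map {n m} θ := TypeCat.ofHom <| Quotient.map
    (fun a => (a.1, a.2.comp θ.unop.toOrderHom)) <| by
      rintro ⟨σ, α⟩ ⟨τ, α'⟩ ⟨rfl : α = α', h⟩
      refine ⟨rfl, ?_⟩
      rcases h with h | ⟨k, hk, h⟩ | ⟨v, hv⟩
      · exact .inl h
      · exact .inr (.inl ⟨k, fun t => hk _, h⟩)
      · exact .inr (.inr ⟨v, fun t => hv _⟩)
  map_id n := by
    refine ConcreteCategory.hom_ext _ _ fun a => ?_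
    induction a using Quotient.inductionOn
    rfl
  map_comp θ η := by
    refine ConcreteCategory.hom_ext _ _ fun a => ?_
    induction a using Quotient.inductionOn
    rfl

end SimplicialDistribution

/-! A twisted distribution on the torus is the same as nine edge expectations `e c`, the probability
of outcome 0 minus that of outcome 1. On a triangle `σ` the four probabilities are `(1 + ∑ ± e) /
4`, over the sign patterns of parity `β(σ)`, so the only constraint is that each row and each column
of the square gives a point of a tetrahedron. The correspondence is affine
(`TwistedDist.isVertex_iff`), which leaves the vertices of a polytope in ℝ⁹ to be found.

Let `D` be the set of cells with `|e c| = 1`. Two tight facets of one tetrahedron make an edge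
deterministic, so besides the equations `v c = 0` on `D` each triangle not contained in `D` imposes
at most one linear condition on a tangent direction. A vertex therefore needs `|D|` plus the number
of such triangles to be at least 9. Since `D` contains the third cell of a line with any two, it is
the graph of a permutation (3 + 6), a row together with a column (5 + 4), or the whole square (9 +
0).

A deterministic edge forces the other two expectations of its triangle to agree up to a known sign
(`Tetrahedron.eq_of_eq_sgn`). In the first two cases the cells outside `D` form a cycle of length 6
or 4 under these relations, and the product of the signs around it is `(-1)^(∑ β(σ))`. Each edge
lies on two triangles, so `∑ β(σ)` is the class of `β`. If it is 0, consistent signs around the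
cycle give a tangent direction, and only deterministic points survive. If it is 1, going around
gives `x = -x`, so the remaining expectations vanish; the point is then determined by its
deterministic edges, hence is a vertex, and a fully deterministic point cannot exist. -/

namespace SimplicialDistribution

open CategoryTheory Simplicial Opposite Convexity

/-! ### Simplices of the Mermin torus -/

/-- The generating triangle labelled `σ`. -/
def merminTri (σ : MerminTriangle) : merminTorus _⦋2⦌ :=
  Quotient.mk (merminSetoid 2) (σ, OrderHom.id)

theorem exists_map_merminTri {n : SimplexCategoryᵒᵖ} (x : merminTorus.obj n) :
    ∃ (σ : MerminTriangle) (θ : n.unop ⟶ ⦋2⦌), merminTorus.map θ.op (merminTri σ) = x := by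
  induction x using Quotient.inductionOn with
  | h a => exact ⟨a.1, SimplexCategory.Hom.mk a.2, rfl⟩

theorem map_merminTri_eq_iff {n : SimplexCategory} (θ θ' : n ⟶ ⦋2⦌) (σ τ : MerminTriangle) :
    merminTorus.map θ.op (merminTri σ) = merminTorus.map θ'.op (merminTri τ) ↔
      θ = θ' ∧ (σ = τ ∨ (∃ k, (∀ t, θ.toOrderHom t ≠ k) ∧ merminFace σ k = merminFace τ k) ∨
        ∃ v, ∀ t, θ.toOrderHom t = v) := by
  refine (Quotient.eq (r := merminSetoid n.len)).trans ?_
  refine and_congr ⟨fun h => SimplexCategory.Hom.ext _ _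
    (OrderHom.ext _ _ (funext fun t => DFunLike.congr_fun h t)), fun h => ?_⟩ Iff.rfl
  subst h; rfl

theorem merminTri_eq_map_id (σ : MerminTriangle) :
    merminTorus.map (𝟙 ⦋2⦌ : ⦋2⦌ ⟶ ⦋2⦌).op (merminTri σ) = merminTri σ := by
  rw [op_id]; exact merminTorus.map_id_apply _ _

theorem merminTri_injective : Function.Injective merminTri := by
  intro σ τ h
  rw [← merminTri_eq_map_id σ, ← merminTri_eq_map_id τ, map_merminTri_eq_iff] at h
  rcases h.2 with h | ⟨k, hk, -⟩ | ⟨v, hv⟩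
  · exact h
  · exact absurd rfl (hk k)
  · have := (hv 0).trans (hv 1).symm
    exact absurd this (by decide)

/-- The edge labelled by a cell of the square. -/
def merminEdge (c : Fin 3 × Fin 3) : merminTorus _⦋1⦌ :=
  merminTorus.δ (c.1 + c.2) (merminTri (.inl c.1))

/-- `merminEdge` is defined through the row triangle; the gluing makes the column triangle yield the
same edge. -/
theorem δ_merminTri (σ : MerminTriangle) (k : Fin 3) :
    merminTorus.δ k (merminTri σ) = merminEdge (merminFace σ k) := by
  have h : (merminFace σ k).1 + (merminFace σ k).2 = k := by
    rcases σ with i | i <;> simp [merminFace]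
  unfold merminEdge
  rw [h]
  refine (map_merminTri_eq_iff (SimplexCategory.δ k) (SimplexCategory.δ k) _ _).2
    ⟨rfl, .inr (.inl ⟨k, fun t => Fin.succAbove_ne k t, ?_⟩)⟩
  rcases σ with i | i <;> simp [merminFace]

theorem merminEdge_injective : Function.Injective merminEdge := by
  rintro ⟨i, j⟩ ⟨i', j'⟩ h
  obtain ⟨h1, h2⟩ := (map_merminTri_eq_iff (SimplexCategory.δ (i + j))
    (SimplexCategory.δ (i' + j')) (.inl i) (.inl i')).1 h
  have hk : i + j = i' + j' := by
    have := congrArg (fun f : ⦋1⦌ ⟶ ⦋2⦌ => (f.toOrderHom : Fin 2 → Fin 3)) h1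
    exact Fin.succAbove_left_injective this
  have hi : i = i' := by
    rcases h2 with h2 | ⟨k, -, h2⟩ | ⟨v, hv⟩
    · exact Sum.inl_injective h2
    · exact (Prod.ext_iff.1 h2).1
    · have : (i + j).succAbove 0 = (i + j).succAbove 1 := (hv 0).trans (hv 1).symm
      exact absurd (Fin.succAbove_right_injective this) (by decide)
  subst hi
  rw [add_left_cancel hk]

/-- A monotone map that is not injective identifies two consecutive vertices and so factors through
a degeneracy. Conversely, the gluing never changes the map `θ`, so a degenerate simplex has its `θ`
factoring through a smaller ordinal. -/
theorem map_merminTri_mem_nonDegenerate_iff {n : ℕ} (θ : ⦋n⦌ ⟶ ⦋2⦌) (σ : MerminTriangle) :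
    merminTorus.map θ.op (merminTri σ) ∈ merminTorus.nonDegenerate n ↔
      Function.Injective θ.toOrderHom := by
  constructor
  · intro h
    by_contra hθ
    apply h
    cases n with
    | zero => exact absurd (fun a b _ => Subsingleton.elim (α := Fin 1) a b) hθ
    | succ n =>
      obtain ⟨t, ht⟩ : ∃ t : Fin (n + 1), θ.toOrderHom t.castSucc = θ.toOrderHom t.succ := by
        by_contra! hne
        exact hθ (Fin.strictMono_iff_lt_succ.2 fun t =>
          (θ.toOrderHom.monotone t.castSucc_lt_succ.le).lt_of_ne (hne t)).injective
      have hfac : SimplexCategory.σ t ≫ SimplexCategory.δ t.succ ≫ θ = θ := by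
        ext s : 3
        change θ.toOrderHom (t.succ.succAbove (t.predAbove s)) = θ.toOrderHom s
        by_cases hs : s = t.succ
        · rw [hs, Fin.predAbove_succ_self, Fin.succAbove_of_castSucc_lt _ _ t.castSucc_lt_succ, ht]
        · congr 1
          exact Fin.succ_succAbove_predAbove hs
      refine ⟨n, n.lt_succ_self, SimplexCategory.σ t,
        merminTorus.map (SimplexCategory.δ t.succ ≫ θ).op (merminTri σ), ?_⟩
      rw [← Functor.map_comp_apply, ← op_comp, hfac]
  · rintro h ⟨m, hm, f, y, hy⟩
    obtain ⟨τ, η, rfl⟩ := exists_map_merminTri y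
    rw [← Functor.map_comp_apply, ← op_comp, map_merminTri_eq_iff] at hy
    have hf : Function.Injective f.toOrderHom := by
      have := hy.1 ▸ h
      exact Function.Injective.of_comp this
    have := Fintype.card_le_of_injective _ hf
    simp at this
    omega

theorem merminTri_mem_nonDegenerate (σ : MerminTriangle) :
    merminTri σ ∈ merminTorus.nonDegenerate 2 := by
  have := (map_merminTri_mem_nonDegenerate_iff (𝟙 ⦋2⦌) σ).2 fun _ _ h => h
  rwa [merminTri_eq_map_id] at this

theorem merminEdge_mem_nonDegenerate (c : Fin 3 × Fin 3) :
    merminEdge c ∈ merminTorus.nonDegenerate 1 :=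
  (map_merminTri_mem_nonDegenerate_iff (SimplexCategory.δ (c.1 + c.2)) _).2
    Fin.succAbove_right_injective

theorem exists_merminTri_of_nonDegenerate {x : merminTorus _⦋2⦌}
    (hx : x ∈ merminTorus.nonDegenerate 2) : ∃ σ, merminTri σ = x := by
  obtain ⟨σ, θ, rfl⟩ := exists_map_merminTri x
  have h := (map_merminTri_mem_nonDegenerate_iff θ σ).1 hx
  have : Mono (θ : ⦋2⦌ ⟶ ⦋2⦌) := SimplexCategory.mono_iff_injective.2 h
  obtain rfl : θ = 𝟙 ⦋2⦌ := SimplexCategory.eq_id_of_mono θ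
  exact ⟨σ, (merminTri_eq_map_id σ).symm⟩

theorem exists_merminEdge_of_nonDegenerate {x : merminTorus _⦋1⦌}
    (hx : x ∈ merminTorus.nonDegenerate 1) : ∃ c, merminEdge c = x := by
  obtain ⟨σ, θ, rfl⟩ := exists_map_merminTri x
  have h := (map_merminTri_mem_nonDegenerate_iff θ σ).1 hx
  have : Mono (θ : ⦋1⦌ ⟶ ⦋2⦌) := SimplexCategory.mono_iff_injective.2 h
  obtain ⟨k, rfl⟩ := SimplexCategory.eq_δ_of_mono θ
  exact ⟨_, (δ_merminTri σ k).symm⟩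

theorem merminEdge_mem_boundaryEdges_iff (c : Fin 3 × Fin 3) (σ : MerminTriangle) :
    merminEdge c ∈ boundaryEdges (merminTri σ) ↔ ∃ k, merminFace σ k = c := by
  unfold boundaryEdges
  simp only [Set.mem_range, δ_merminTri, merminEdge_injective.eq_iff]

theorem subsingleton_merminTorus_zero_map {n : SimplexCategory} (θ : n ⟶ ⦋2⦌)
    (hθ : ∃ v, ∀ t, θ.toOrderHom t = v) (σ τ : MerminTriangle) :
    merminTorus.map θ.op (merminTri σ) = merminTorus.map θ.op (merminTri τ) :=
  (map_merminTri_eq_iff θ θ σ τ).2 ⟨rfl, .inr (.inr hθ)⟩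

/-! ### The polytope of edge expectations -/

/-- The sign `(-1)^t`. -/
noncomputable def sgn (t : ZMod 2) : ℝ := if t = 0 then 1 else -1

theorem zmod_two_cases (t : ZMod 2) : t = 0 ∨ t = 1 := by
  revert t; decide

@[simp] theorem sgn_zero : sgn 0 = 1 := by simp [sgn]

@[simp] theorem sgn_one : sgn 1 = -1 := by simp [sgn]

theorem sgn_add (s t : ZMod 2) : sgn (s + t) = sgn s * sgn t := by
  rcases zmod_two_cases s with rfl | rfl <;> rcases zmod_two_cases t with rfl | rfl <;>
    simp [show (1 + 1 : ZMod 2) = 0 from rfl]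

@[simp] theorem sgn_mul_self (s : ZMod 2) : sgn s * sgn s = 1 := by
  rcases zmod_two_cases s with rfl | rfl <;> simp

@[simp] theorem abs_sgn (s : ZMod 2) : |sgn s| = 1 := by
  rcases zmod_two_cases s with rfl | rfl <;> simp

theorem sgn_injective : Function.Injective sgn := by
  intro s t h
  rcases zmod_two_cases s with rfl | rfl <;> rcases zmod_two_cases t with rfl | rfl <;>
    simp at h ⊢ <;> norm_num at h

theorem exists_sgn_of_abs_eq_one {x : ℝ} (h : |x| = 1) : ∃ t, x = sgn t := by
  rcases eq_or_eq_neg_of_abs_eq h with h | h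
  · exact ⟨0, by simp [h]⟩
  · exact ⟨1, by simp [h]⟩

/-- The tetrahedron of the expectations `f k` of three bits with sum `t`. -/
def Tetrahedron (t : ZMod 2) (f : Fin 3 → ℝ) : Prop :=
  ∀ s : Fin 3 → ZMod 2, ∑ k, s k = t → 0 ≤ 1 + ∑ k, sgn (s k) * f k

theorem sum_fin_three_of_ne {M : Type*} [AddCommMonoid M] (f : Fin 3 → M) {k l m : Fin 3}
    (hkl : k ≠ l) (hkm : k ≠ m) (hlm : l ≠ m) : ∑ i, f i = f k + f l + f m := by
  have : (Finset.univ : Finset (Fin 3)) = {k, l, m} := by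
    revert k l m; decide
  rw [this, Finset.sum_insert (by simp [hkl, hkm]), Finset.sum_insert (by simp [hlm]),
    Finset.sum_singleton, add_assoc]

theorem Tetrahedron.nonneg {t : ZMod 2} {f : Fin 3 → ℝ} (h : Tetrahedron t f) {k l m : Fin 3}
    (hkl : k ≠ l) (hkm : k ≠ m) (hlm : l ≠ m) (a c : ZMod 2) :
    0 ≤ 1 + (sgn a * f k + sgn c * f l + sgn (t + a + c) * f m) := by
  have h2 : ∀ x y : ZMod 2, x + y + (t + x + y) = t := by
    clear h; revert t; decide
  have := h (fun i => if i = k then a else if i = l then c else t + a + c) <| by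
    rw [sum_fin_three_of_ne _ hkl hkm hlm]
    simp [hkl.symm, hkm.symm, hlm.symm, h2]
  rw [sum_fin_three_of_ne _ hkl hkm hlm] at this
  simpa [hkl.symm, hkm.symm, hlm.symm] using this

theorem exists_ne_ne (k : Fin 3) : ∃ l m, k ≠ l ∧ k ≠ m ∧ l ≠ m := by
  revert k; decide

theorem Tetrahedron.abs_le_one {t : ZMod 2} {f : Fin 3 → ℝ} (h : Tetrahedron t f) (k : Fin 3) :
    |f k| ≤ 1 := by
  obtain ⟨l, m, hkl, hkm, hlm⟩ := exists_ne_ne k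
  have h1 := h.nonneg hkl hkm hlm 0 0
  have h2 := h.nonneg hkl hkm hlm 0 1
  have h3 := h.nonneg hkl hkm hlm 1 0
  have h4 := h.nonneg hkl hkm hlm 1 1
  simp only [sgn_add, sgn_zero, sgn_one] at h1 h2 h3 h4
  rw [abs_le]
  constructor <;> linarith

/-- In the two facet inequalities with `s k = a + 1` the constant 1 cancels against `f k`; what
remains bounds `f l - sgn (t + a) * f m` by 0 from both sides. -/
theorem Tetrahedron.eq_of_eq_sgn {t a : ZMod 2} {f : Fin 3 → ℝ} (h : Tetrahedron t f)
    {k l m : Fin 3} (hkl : k ≠ l) (hkm : k ≠ m) (hlm : l ≠ m) (hk : f k = sgn a) :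
    f l = sgn (t + a) * f m := by
  have h1 := h.nonneg hkl hkm hlm (a + 1) 0
  have h2 := h.nonneg hkl hkm hlm (a + 1) 1
  have h3 := sgn_mul_self a
  simp only [sgn_add, sgn_zero, sgn_one, hk] at h1 h2 ⊢
  linarith

theorem Tetrahedron.abs_eq_one {t : ZMod 2} {f : Fin 3 → ℝ} (h : Tetrahedron t f)
    {k l m : Fin 3} (hkl : k ≠ l) (hkm : k ≠ m) (hlm : l ≠ m) (hk : |f k| = 1) (hl : |f l| = 1) :
    |f m| = 1 := by
  obtain ⟨a, ha⟩ := exists_sgn_of_abs_eq_one hk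
  rw [h.eq_of_eq_sgn hkl hkm hlm ha, abs_mul, abs_sgn, one_mul] at hl
  exact hl

/-- A direction `v` tangent to all facets of the tetrahedron that contain `f`. -/
def IsTangent (t : ZMod 2) (f v : Fin 3 → ℝ) : Prop :=
  ∀ s : Fin 3 → ZMod 2, ∑ k, s k = t → 1 + ∑ k, sgn (s k) * f k = 0 → ∑ k, sgn (s k) * v k = 0

theorem exists_eq_and_eq_add_one (s s' : Fin 3 → ZMod 2) (h : ∑ k, s k = ∑ k, s' k)
    (hne : s ≠ s') :
    ∃ k l m, k ≠ l ∧ k ≠ m ∧ l ≠ m ∧ s' k = s k ∧ s' l = s l + 1 ∧ s' m = s m + 1 := by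
  rw [Fin.sum_univ_three, Fin.sum_univ_three] at h
  revert s s'
  set_option synthInstance.maxSize 4000 in
  set_option synthInstance.maxHeartbeats 400000 in
  decide

/-- Two facets differ in exactly two signs. If both are tight, adding the equations shows that the
common coordinate is ±1, where `v` vanishes; the two conditions on `v` then differ only by an
overall sign. Hence one condition per triangle suffices. -/
theorem isTangent_of_tight {t : ZMod 2} {f v : Fin 3 → ℝ}
    (hv : ∀ k, |f k| = 1 → v k = 0) {s : Fin 3 → ZMod 2} (hs : ∑ k, s k = t)
    (hs0 : 1 + ∑ k, sgn (s k) * f k = 0) (hsv : ∑ k, sgn (s k) * v k = 0) :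
    IsTangent t f v := by
  intro s' hs' hs0'
  by_cases hss : s = s'
  · exact hss ▸ hsv
  obtain ⟨k, l, m, hkl, hkm, hlm, h1, h2, h3⟩ :=
    exists_eq_and_eq_add_one s s' (hs.trans hs'.symm) hss
  rw [sum_fin_three_of_ne _ hkl hkm hlm] at hs0 hsv hs0' ⊢
  rw [h1, h2, h3, sgn_add, sgn_add, sgn_one] at hs0'
  rw [h1, h2, h3, sgn_add, sgn_add, sgn_one]
  have hk : f k = sgn (s k + 1) := by
    have := sgn_mul_self (s k)
    have h4 : sgn (s k) * f k = -1 := by linarith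
    rw [sgn_add, sgn_one]
    linear_combination (-f k) * this + sgn (s k) * h4
  rw [hv k (by rw [hk, abs_sgn])] at hsv ⊢
  linarith

/-- A tight facet with `s k = a` would force `|f l| = 1`. The facets with `s k = a + 1` have exactly
the assumed relation between `v l` and `v m` as tangency condition. -/
theorem isTangent_of_eq_sgn {t a : ZMod 2} {f v : Fin 3 → ℝ} (h : Tetrahedron t f)
    {k l m : Fin 3} (hkl : k ≠ l) (hkm : k ≠ m) (hlm : l ≠ m) (hk : f k = sgn a)
    (hl : |f l| ≠ 1) (hvk : v k = 0) (hv : v l = sgn (t + a) * v m) : IsTangent t f v := by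
  intro s hs hs0
  have hrel := h.eq_of_eq_sgn hkl hkm hlm hk
  rw [sum_fin_three_of_ne _ hkl hkm hlm] at hs hs0 ⊢
  rw [hvk, hv]
  rw [hk] at hs0
  have hsm : s m = t + s k + s l := by
    rw [← hs]; generalize s k = x; generalize s l = y; generalize s m = z
    revert x y z; decide
  have htwo : ∀ x y : ZMod 2, x = y ∨ x = y + 1 := by decide
  rcases htwo (s k) a with hka | hka
  · exfalso
    apply hl
    rw [hsm, hka] at hs0
    simp only [sgn_add, sgn_mul_self] at hs0 hrel
    have h1 := sgn_mul_self t
    have h2 := sgn_mul_self a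
    have h3 := sgn_mul_self (s l)
    have h4 : sgn (s l) * f l = -1 := by
      rw [hrel] at hs0 ⊢
      linear_combination (1 / 2) * hs0
    have h5 : f l = sgn (s l + 1) := by
      rw [sgn_add, sgn_one]; linear_combination (-f l) * h3 + sgn (s l) * h4
    rw [h5, abs_sgn]
  · rw [hsm, hka]
    simp only [sgn_add, sgn_one]
    ring

/-- The `k`-th cell of a row or column. -/
def squareLine (σ : MerminTriangle) (k : Fin 3) : Fin 3 × Fin 3 :=
  Sum.elim (fun i => (i, k)) (fun j => (k, j)) σ

/-- The polytope of the edge expectations of twisted distributions. -/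
def expectationPolytope (b : MerminTriangle → ZMod 2) : Set (Fin 3 × Fin 3 → ℝ) :=
  {e | ∀ σ, Tetrahedron (b σ) fun k => e (squareLine σ k)}

-- For small `t` the slack inequalities stay strict and the tight ones stay equalities, so `e` is
-- the midpoint of `e + t • v` and `e - t • v` inside the polytope.
open Topology in
theorem notMem_extremePoints_of_isTangent {b : MerminTriangle → ZMod 2} {e v : Fin 3 × Fin 3 → ℝ}
    (he : e ∈ expectationPolytope b) (hv0 : v ≠ 0)
    (hv : ∀ σ, IsTangent (b σ) (fun k => e (squareLine σ k)) (fun k => v (squareLine σ k))) :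
    e ∉ (expectationPolytope b).extremePoints ℝ := by
  have hev : ∀ᶠ t : ℝ in 𝓝 0, e + t • v ∈ expectationPolytope b := by
    have : ∀ σ, ∀ s : Fin 3 → ZMod 2, ∀ᶠ t : ℝ in 𝓝 0, ∑ k, s k = b σ →
        0 ≤ 1 + ∑ k, sgn (s k) * (e + t • v) (squareLine σ k) := by
      intro σ s
      by_cases hs : ∑ k, s k = b σ
      · have hexp : ∀ t : ℝ, 1 + ∑ k, sgn (s k) * (e + t • v) (squareLine σ k) =
            (1 + ∑ k, sgn (s k) * e (squareLine σ k)) +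
              t * ∑ k, sgn (s k) * v (squareLine σ k) := by
          intro t
          simp only [Pi.add_apply, Pi.smul_apply, smul_eq_mul, mul_add, Finset.sum_add_distrib,
            Finset.mul_sum, add_assoc]
          congr 2
          exact Finset.sum_congr rfl fun k _ => by ring
        simp only [hexp]
        rcases (he σ s hs).eq_or_lt with h0 | h0
        · rw [hv σ s hs h0.symm]
          exact .of_forall fun t _ => by rw [← h0]; simp
        · have hc : Filter.Tendsto (fun t : ℝ => (1 + ∑ k, sgn (s k) * e (squareLine σ k)) +
              t * ∑ k, sgn (s k) * v (squareLine σ k)) (𝓝 0)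
              (𝓝 ((1 + ∑ k, sgn (s k) * e (squareLine σ k)) +
                0 * ∑ k, sgn (s k) * v (squareLine σ k))) :=
            (Continuous.tendsto (by fun_prop) 0)
          rw [zero_mul, add_zero] at hc
          exact (hc.eventually (lt_mem_nhds h0)).mono fun t ht _ => ht.le
      · exact .of_forall fun t h => absurd h hs
    exact (Filter.eventually_all.2 fun σ => Filter.eventually_all.2 (this σ)).mono
      fun t ht σ s hs => ht σ s hs
  have hneg : ∀ᶠ t : ℝ in 𝓝 0, e + (-t) • v ∈ expectationPolytope b := by
    have : Filter.Tendsto (fun t : ℝ => -t) (𝓝 0) (𝓝 0) := by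
      simpa using (continuous_neg.tendsto (0 : ℝ))
    exact this.eventually hev
  obtain ⟨t, ⟨h1, h2⟩, ht⟩ :=
    (((hev.and hneg).filter_mono nhdsWithin_le_nhds).and
      (self_mem_nhdsWithin (s := Set.Ioi (0 : ℝ)))).exists
  intro hext
  have hseg : e ∈ openSegment ℝ (e + t • v) (e + (-t) • v) :=
    ⟨1 / 2, 1 / 2, by norm_num, by norm_num, by norm_num, by module⟩
  have := (mem_extremePoints.1 hext).2 _ h1 _ h2 hseg
  have h3 : t • v = 0 := by simpa using this.1
  exact hv0 ((smul_eq_zero.1 h3).resolve_left ht.ne')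

/-- A vertex satisfies at least nine independent equations. -/
theorem nine_le_of_mem_extremePoints {b : MerminTriangle → ZMod 2} {e : Fin 3 × Fin 3 → ℝ}
    (hext : e ∈ (expectationPolytope b).extremePoints ℝ) (D : Finset (Fin 3 × Fin 3))
    (hD : ∀ c, c ∈ D ↔ |e c| = 1) :
    9 ≤ D.card + (Finset.univ.filter fun σ : MerminTriangle => ¬ ∀ k, squareLine σ k ∈ D).card := by
  classical
  by_contra! hlt
  -- One linear form per triangle: that of some tight facet, or 0 if no facet is tight.
  have htight : ∀ σ, ∃ ℓ : (Fin 3 × Fin 3 → ℝ) →ₗ[ℝ] ℝ, ∀ v, (∀ c ∈ D, v c = 0) → ℓ v = 0 →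
      IsTangent (b σ) (fun k => e (squareLine σ k)) (fun k => v (squareLine σ k)) := by
    intro σ
    by_cases h : ∃ s : Fin 3 → ZMod 2, ∑ k, s k = b σ ∧
        1 + ∑ k, sgn (s k) * e (squareLine σ k) = 0
    · obtain ⟨s, hs, hs0⟩ := h
      refine ⟨∑ k, sgn (s k) • LinearMap.proj (squareLine σ k), fun v hv hℓ =>
        isTangent_of_tight (fun k hk => hv _ ((hD _).2 hk)) hs hs0 ?_⟩
      simpa [LinearMap.sum_apply] using hℓ
    · exact ⟨0, fun v _ _ s hs hs0 => absurd ⟨s, hs, hs0⟩ h⟩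
  choose ℓ hℓ using htight
  let F := Finset.univ.filter fun σ : MerminTriangle => ¬ ∀ k, squareLine σ k ∈ D
  let Φ : (Fin 3 × Fin 3 → ℝ) →ₗ[ℝ] (D ⊕ F → ℝ) :=
    LinearMap.pi (Sum.elim (fun c => LinearMap.proj c.1) fun σ => ℓ σ.1)
  -- Fewer than nine equations on ℝ⁹ have a nonzero solution.
  have hker : LinearMap.ker Φ ≠ ⊥ := by
    apply LinearMap.ker_ne_bot_of_finrank_lt
    simp only [Module.finrank_fintype_fun_eq_card, Fintype.card_sum, Fintype.card_coe,
      Fintype.card_prod, Fintype.card_fin]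
    simpa [F] using hlt
  obtain ⟨v, hv, hv0⟩ := (Submodule.ne_bot_iff _).1 hker
  have hvD : ∀ c ∈ D, v c = 0 := fun c hc => congrFun (LinearMap.mem_ker.1 hv) (.inl ⟨c, hc⟩)
  refine notMem_extremePoints_of_isTangent hext.1 hv0 (fun σ => ?_) hext
  by_cases hσ : ∀ k, squareLine σ k ∈ D
  · intro s _ _
    exact Finset.sum_eq_zero fun k _ => by
      simp only [hvD _ (hσ k), mul_zero]
  · exact hℓ σ v hvD (congrFun (LinearMap.mem_ker.1 hv) (.inr ⟨σ, by simpa [F] using hσ⟩))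

/-- A finite check over the 512 subsets of the square. -/
theorem square_classification (D : Finset (Fin 3 × Fin 3))
    (hD : ∀ σ k l m, k ≠ l → k ≠ m → l ≠ m → squareLine σ k ∈ D → squareLine σ l ∈ D →
      squareLine σ m ∈ D)
    (hcard : 9 ≤ D.card +
      (Finset.univ.filter fun σ : MerminTriangle => ¬ ∀ k, squareLine σ k ∈ D).card) :
    (∃ π : Equiv.Perm (Fin 3), ∀ i j, (i, j) ∈ D ↔ j = π i) ∨
      (∃ i₀ j₀, ∀ i j, (i, j) ∈ D ↔ i = i₀ ∨ j = j₀) ∨ D = Finset.univ := by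
  set_option maxRecDepth 100000 in
  set_option synthInstance.maxSize 4000 in
  set_option synthInstance.maxHeartbeats 400000 in
  revert D
  decide +kernel

/-! ### Permuting the rows and columns of the square -/

theorem Tetrahedron.comp_perm {t : ZMod 2} {f : Fin 3 → ℝ} (h : Tetrahedron t f)
    (π : Equiv.Perm (Fin 3)) : Tetrahedron t (f ∘ π) := by
  intro s hs
  have := h (s ∘ π.symm) (by rw [← hs]; exact Equiv.sum_comp π.symm s)
  rw [← Equiv.sum_comp π] at this
  simpa using this

theorem prodMap_squareLine (ρ κ : Equiv.Perm (Fin 3)) (σ : MerminTriangle) (k : Fin 3) :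
    Prod.map ρ κ (squareLine σ k) =
      squareLine (Sum.map ρ κ σ) (Sum.elim (fun _ => κ) (fun _ => ρ) σ k) := by
  rcases σ with i | j <;> rfl

theorem comp_prodMap_mem {b : MerminTriangle → ZMod 2} {e : Fin 3 × Fin 3 → ℝ}
    (he : e ∈ expectationPolytope b) (ρ κ : Equiv.Perm (Fin 3)) :
    e ∘ Prod.map ρ κ ∈ expectationPolytope (b ∘ Sum.map ρ κ) := by
  intro σ
  have := (he (Sum.map ρ κ σ)).comp_perm (Sum.elim (fun _ => κ) (fun _ => ρ) σ)
  simpa only [Function.comp_def, prodMap_squareLine] using this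

/-- Relabelling rows and columns is a linear isomorphism of polytopes; it moves the deterministic
cells to the diagonal, or to the cross through `(0, 0)`. -/
theorem comp_prodMap_mem_extremePoints {b : MerminTriangle → ZMod 2} {e : Fin 3 × Fin 3 → ℝ}
    (he : e ∈ (expectationPolytope b).extremePoints ℝ) (ρ κ : Equiv.Perm (Fin 3)) :
    e ∘ Prod.map ρ κ ∈ (expectationPolytope (b ∘ Sum.map ρ κ)).extremePoints ℝ := by
  have hb : (b ∘ Sum.map ρ κ) ∘ Sum.map ρ.symm κ.symm = b := by
    funext σ; rcases σ with i | j <;> simp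
  have h1 : ∀ x : Fin 3 × Fin 3 → ℝ, (x ∘ Prod.map ρ.symm κ.symm) ∘ Prod.map ρ κ = x := by
    intro x; funext ⟨i, j⟩; simp
  rw [mem_extremePoints] at he ⊢
  refine ⟨comp_prodMap_mem he.1 ρ κ, fun x hx y hy ⟨s, t, hs, ht, hst, hxy⟩ => ?_⟩
  have hx' := comp_prodMap_mem hx ρ.symm κ.symm
  have hy' := comp_prodMap_mem hy ρ.symm κ.symm
  rw [hb] at hx' hy'
  have := he.2 _ hx' _ hy' ⟨s, t, hs, ht, hst, by
    funext ⟨i, j⟩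
    simpa using congrFun hxy (ρ.symm i, κ.symm j)⟩
  rw [← h1 x, ← h1 y]
  exact ⟨congrArg (· ∘ Prod.map ρ κ) this.1, congrArg (· ∘ Prod.map ρ κ) this.2⟩

theorem sum_comp_sumMap (b : MerminTriangle → ZMod 2) (ρ κ : Equiv.Perm (Fin 3)) :
    ∑ σ, (b ∘ Sum.map ρ κ) σ = ∑ σ, b σ := by
  simp only [Fintype.sum_sum_type, Function.comp_apply, Sum.map_inl, Sum.map_inr]
  rw [Equiv.sum_comp ρ fun i => b (.inl i), Equiv.sum_comp κ fun i => b (.inr i)]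

/-! ### Expectations with three or five deterministic edges -/

theorem exists_third (i j : Fin 3) : ∃ k, i ≠ k ∧ j ≠ k := by
  revert i j; decide

theorem eq_zero_of_eq_sgn_mul_self {x : ℝ} {t : ZMod 2} (ht : t = 1) (h : x = sgn t * x) :
    x = 0 := by
  rw [ht, sgn_one] at h
  linarith

/-- The six off-diagonal cells form a hexagon, each side of which is a row or column whose diagonal
cell is deterministic. Every diagonal outcome enters two of the signs and cancels, leaving the total
sign `(-1)^(∑ b)`. -/
theorem diagonal_eq_zero {b : MerminTriangle → ZMod 2} {e : Fin 3 × Fin 3 → ℝ}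
    (he : e ∈ expectationPolytope b) (hb : ∑ σ, b σ = 1) (hD : ∀ i, |e (i, i)| = 1)
    {i j : Fin 3} (hij : i ≠ j) : e (i, j) = 0 := by
  choose a ha using fun i => exists_sgn_of_abs_eq_one (hD i)
  have hr : ∀ k l m, k ≠ l → k ≠ m → l ≠ m → e (k, l) = sgn (b (.inl k) + a k) * e (k, m) :=
    fun k l m h1 h2 h3 => (he (.inl k)).eq_of_eq_sgn h1 h2 h3 (ha k)
  have hc : ∀ k l m, k ≠ l → k ≠ m → l ≠ m → e (l, k) = sgn (b (.inr k) + a k) * e (m, k) :=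
    fun k l m h1 h2 h3 => (he (.inr k)).eq_of_eq_sgn h1 h2 h3 (ha k)
  obtain ⟨k, hik, hjk⟩ : ∃ k, i ≠ k ∧ j ≠ k := exists_third i j
  have hx : ∀ x : ZMod 2, x + x = 0 := by decide
  refine eq_zero_of_eq_sgn_mul_self (t := (b (.inl i) + a i) + ((b (.inr k) + a k) +
    ((b (.inl j) + a j) + ((b (.inr i) + a i) + ((b (.inl k) + a k) + (b (.inr j) + a j)))))) ?_ ?_
  · rw [Fintype.sum_sum_type, sum_fin_three_of_ne _ hij hik hjk,
      sum_fin_three_of_ne _ hij hik hjk] at hb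
    linear_combination hb + hx (a i) + hx (a j) + hx (a k)
  · calc e (i, j) = _ := hr i j k hij hik hjk
      _ = _ := by rw [hc k i j hik.symm hjk.symm hij, hr j k i hjk hij.symm hik.symm,
        hc i j k hij hik hjk, hr k i j hik.symm hjk.symm hij, hc j k i hjk hij.symm hik.symm]
      _ = _ := by simp only [sgn_add]; ring

/-- The four cells off the cross form a cycle. Its sign involves the four other triangles and the
outcomes on the cross away from the corner; the two deterministic triangles (`hrb`, `hcb`) convert
these outcomes into their own values of `b`, which completes `∑ b`. -/
theorem cross_eq_zero {b : MerminTriangle → ZMod 2} {e : Fin 3 × Fin 3 → ℝ}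
    (he : e ∈ expectationPolytope b) (hb : ∑ σ, b σ = 1) {i₀ j₀ : Fin 3}
    (hr₀ : ∀ j, |e (i₀, j)| = 1) (hc₀ : ∀ i, |e (i, j₀)| = 1)
    {i j : Fin 3} (hi : i₀ ≠ i) (hj : j₀ ≠ j) : e (i, j) = 0 := by
  choose r hr using fun j => exists_sgn_of_abs_eq_one (hr₀ j)
  choose c hc using fun i => exists_sgn_of_abs_eq_one (hc₀ i)
  obtain ⟨k, hik, hk⟩ : ∃ k, i₀ ≠ k ∧ i ≠ k := exists_third i₀ i
  obtain ⟨l, hjl, hl⟩ : ∃ k, j₀ ≠ k ∧ j ≠ k := exists_third j₀ j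
  have hrow : ∀ i l m, j₀ ≠ l → j₀ ≠ m → l ≠ m → e (i, l) = sgn (b (.inl i) + c i) * e (i, m) :=
    fun k l m h1 h2 h3 => (he (.inl k)).eq_of_eq_sgn h1 h2 h3 (hc k)
  have hcol : ∀ j l m, i₀ ≠ l → i₀ ≠ m → l ≠ m → e (l, j) = sgn (b (.inr j) + r j) * e (m, j) :=
    fun k l m h1 h2 h3 => (he (.inr k)).eq_of_eq_sgn h1 h2 h3 (hr k)
  have hrc : r j₀ = c i₀ := sgn_injective ((hr j₀).symm.trans (hc i₀))
  have hx : ∀ x : ZMod 2, x + x = 0 := by decide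
  have hrb : r j = (b (.inl i₀) + r j₀) + r l := sgn_injective <| by
    rw [sgn_add, ← hr l, ← hr j]
    exact (he (.inl i₀)).eq_of_eq_sgn hj hjl hl (hr j₀)
  have hcb : c i = (b (.inr j₀) + c i₀) + c k := sgn_injective <| by
    rw [sgn_add, ← hc k, ← hc i]
    exact (he (.inr j₀)).eq_of_eq_sgn hi hik hk (hc i₀)
  refine eq_zero_of_eq_sgn_mul_self (t := (b (.inl i) + c i) + ((b (.inr l) + r l) +
    ((b (.inl k) + c k) + (b (.inr j) + r j)))) ?_ ?_
  · rw [Fintype.sum_sum_type, sum_fin_three_of_ne _ hi hik hk,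
      sum_fin_three_of_ne _ hj hjl hl] at hb
    linear_combination hb + hrb + hcb + hx (c k) + hx (r l) + hrc + hx (c i₀)
  · calc e (i, j) = _ := hrow i j l hj hjl hl
      _ = _ := by rw [hcol l i k hi hik hk, hrow k l j hjl hj hl.symm, hcol j k i hik hi hk.symm]
      _ = _ := by simp only [sgn_add]; ring

/-- Now the sign around the hexagon is trivial, so signs compatible with all six relations exist and
form a tangent direction. -/
theorem diagonal_notMem_extremePoints {b : MerminTriangle → ZMod 2} {e : Fin 3 × Fin 3 → ℝ}
    (hb : ∑ σ, b σ = 0) (hD : ∀ i j, |e (i, j)| = 1 ↔ i = j) :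
    e ∉ (expectationPolytope b).extremePoints ℝ := by
  intro hext
  have he := hext.1
  choose a ha using fun i => exists_sgn_of_abs_eq_one ((hD i i).2 rfl)
  let r : Fin 3 → ZMod 2 := fun i => b (.inl i) + a i
  let c : Fin 3 → ZMod 2 := fun i => b (.inr i) + a i
  have hx : ∀ x : ZMod 2, x + x = 0 := by decide
  have hrc : r 0 + c 2 + r 1 + c 0 + r 2 = c 1 := by
    rw [Fintype.sum_sum_type, Fin.sum_univ_three, Fin.sum_univ_three] at hb
    simp only [r, c]
    linear_combination hb + hx (a 0) + hx (a 2) - hx (b (.inr 1))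
  -- Exponents propagated from 0 along `(0,1), (0,2), (1,2), (1,0), (2,0), (2,1)`; `hrc` closes the
  -- cycle in column 1.
  let w : Fin 3 → Fin 3 → ZMod 2 :=
    ![![0, 0, r 0], ![r 0 + c 2 + r 1, 0, r 0 + c 2],
      ![r 0 + c 2 + r 1 + c 0, r 0 + c 2 + r 1 + c 0 + r 2, 0]]
  let v : Fin 3 × Fin 3 → ℝ := fun x => if x.1 = x.2 then 0 else sgn (w x.1 x.2)
  have hv0 : v ≠ 0 := fun h => by simpa [v, w] using congrFun h (0, 1)
  have hrow : ∀ k l m, k ≠ l → k ≠ m → l ≠ m → w k l = r k + w k m →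
      IsTangent (b (.inl k)) (fun x => e (k, x)) (fun x => v (k, x)) :=
    fun k l m hkl hkm hlm hw => isTangent_of_eq_sgn (he (.inl k)) hkl hkm hlm (ha k)
      (fun h => hkl ((hD _ _).1 h)) (by simp [v]) (by simp [v, hkl, hkm, hw, sgn_add, r])
  have hcol : ∀ k l m, k ≠ l → k ≠ m → l ≠ m → w l k = c k + w m k →
      IsTangent (b (.inr k)) (fun x => e (x, k)) (fun x => v (x, k)) :=
    fun k l m hkl hkm hlm hw => isTangent_of_eq_sgn (he (.inr k)) hkl hkm hlm (ha k)
      (fun h => hkl ((hD _ _).1 h).symm) (by simp [v])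
      (by simp [v, hkl.symm, hkm.symm, hw, sgn_add, c])
  refine notMem_extremePoints_of_isTangent he hv0 ?_ hext
  rintro (k | k) <;> fin_cases k
  · exact hrow 0 2 1 (by decide) (by decide) (by decide) (by simp [w])
  · exact hrow 1 0 2 (by decide) (by decide) (by decide) (by simp [w, add_comm])
  · exact hrow 2 1 0 (by decide) (by decide) (by decide) (by simp [w, add_comm])
  · exact hcol 0 2 1 (by decide) (by decide) (by decide) (by simp [w, add_comm])
  · exact hcol 1 2 0 (by decide) (by decide) (by decide) (by simp [w, hrc])
  · exact hcol 2 1 0 (by decide) (by decide) (by decide) (by simp [w, add_comm])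

theorem cross_notMem_extremePoints {b : MerminTriangle → ZMod 2} {e : Fin 3 × Fin 3 → ℝ}
    (hb : ∑ σ, b σ = 0) (hD : ∀ i j, |e (i, j)| = 1 ↔ i = 0 ∨ j = 0) :
    e ∉ (expectationPolytope b).extremePoints ℝ := by
  intro hext
  have he := hext.1
  choose p hp using fun j => exists_sgn_of_abs_eq_one ((hD 0 j).2 (.inl rfl))
  choose q hq using fun i => exists_sgn_of_abs_eq_one ((hD i 0).2 (.inr rfl))
  let r : Fin 3 → ZMod 2 := fun i => b (.inl i) + q i
  let c : Fin 3 → ZMod 2 := fun i => b (.inr i) + p i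
  have hx : ∀ x : ZMod 2, x + x = 0 := by decide
  have hpq : p 0 = q 0 := sgn_injective ((hp 0).symm.trans (hq 0))
  have hpb : p 1 = (b (.inl 0) + p 0) + p 2 := sgn_injective <| by
    rw [sgn_add, ← hp 1, ← hp 2]
    exact (he (.inl 0)).eq_of_eq_sgn (k := 0) (by decide) (by decide) (by decide) (hp 0)
  have hqb : q 1 = (b (.inr 0) + q 0) + q 2 := sgn_injective <| by
    rw [sgn_add, ← hq 1, ← hq 2]
    exact (he (.inr 0)).eq_of_eq_sgn (k := 0) (by decide) (by decide) (by decide) (hq 0)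
  have hrc : r 1 + c 2 = r 2 + c 1 := by
    rw [Fintype.sum_sum_type, Fin.sum_univ_three, Fin.sum_univ_three] at hb
    simp only [r, c]
    linear_combination hb + hqb - hpb - hx (b (.inr 1)) - hx (b (.inl 2)) - hx (b (.inl 0)) - hpq
  -- Exponents propagated from `(1,1)` to its neighbours and on to `(2,2)`; `hrc` makes row 2
  -- consistent.
  let w : Fin 3 → Fin 3 → ZMod 2 := ![![0, 0, 0], ![0, 0, r 1], ![0, c 1, r 1 + c 2]]
  let v : Fin 3 × Fin 3 → ℝ := fun x => if x.1 = 0 ∨ x.2 = 0 then 0 else sgn (w x.1 x.2)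
  have hv0 : v ≠ 0 := fun h => by simpa [v, w] using congrFun h (1, 1)
  have hrow : ∀ k l m, k ≠ 0 → 0 ≠ l → 0 ≠ m → l ≠ m → w k l = r k + w k m →
      IsTangent (b (.inl k)) (fun x => e (k, x)) (fun x => v (k, x)) :=
    fun k l m hk hkl hkm hlm hw => isTangent_of_eq_sgn (he (.inl k)) hkl hkm hlm (hq k)
      (fun h => ((hD _ _).1 h).elim hk hkl.symm) (by simp [v])
      (by simp [v, hk, hkl.symm, hkm.symm, hw, sgn_add, r])
  have hcol : ∀ k l m, k ≠ 0 → 0 ≠ l → 0 ≠ m → l ≠ m → w l k = c k + w m k →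
      IsTangent (b (.inr k)) (fun x => e (x, k)) (fun x => v (x, k)) :=
    fun k l m hk hkl hkm hlm hw => isTangent_of_eq_sgn (he (.inr k)) hkl hkm hlm (hp k)
      (fun h => ((hD _ _).1 h).elim hkl.symm hk) (by simp [v])
      (by simp [v, hk, hkl.symm, hkm.symm, hw, sgn_add, c])
  refine notMem_extremePoints_of_isTangent he hv0 ?_ hext
  rintro (k | k) <;> fin_cases k
  · exact fun s _ _ => by simp [v, squareLine]
  · exact hrow 1 2 1 (by decide) (by decide) (by decide) (by decide) (by simp [w])
  · exact hrow 2 2 1 (by decide) (by decide) (by decide) (by decide) (by simp [w, hrc])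
  · exact fun s _ _ => by simp [v, squareLine]
  · exact hcol 1 2 1 (by decide) (by decide) (by decide) (by decide) (by simp [w])
  · exact hcol 2 2 1 (by decide) (by decide) (by decide) (by decide) (by simp [w, add_comm])

/-! ### The vertices of the polytope -/

theorem extremePoints_cases {b : MerminTriangle → ZMod 2} {e : Fin 3 × Fin 3 → ℝ}
    (hext : e ∈ (expectationPolytope b).extremePoints ℝ) :
    (∃ π : Equiv.Perm (Fin 3), ∀ i j, |e (i, j)| = 1 ↔ j = π i) ∨
      (∃ i₀ j₀, ∀ i j, |e (i, j)| = 1 ↔ i = i₀ ∨ j = j₀) ∨ ∀ c, |e c| = 1 := by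
  classical
  let D := Finset.univ.filter fun c => |e c| = 1
  have hD : ∀ c, c ∈ D ↔ |e c| = 1 := fun c => by simp [D]
  have := square_classification D (fun σ k l m hkl hkm hlm => by
    simp only [hD]; exact (hext.1 σ).abs_eq_one hkl hkm hlm)
    (nine_le_of_mem_extremePoints hext D hD)
  simpa only [hD, Finset.eq_univ_iff_forall] using this

theorem abs_eq_one_of_mem_extremePoints {b : MerminTriangle → ZMod 2} {e : Fin 3 × Fin 3 → ℝ}
    (hext : e ∈ (expectationPolytope b).extremePoints ℝ) (hb : ∑ σ, b σ = 0) (c : Fin 3 × Fin 3) :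
    |e c| = 1 := by
  rcases extremePoints_cases hext with ⟨π, hπ⟩ | ⟨i₀, j₀, h⟩ | h
  · refine absurd (comp_prodMap_mem_extremePoints hext (Equiv.refl _) π)
      (diagonal_notMem_extremePoints (by rw [sum_comp_sumMap, hb]) fun i j => ?_)
    simpa [eq_comm] using hπ i (π j)
  · refine absurd (comp_prodMap_mem_extremePoints hext (Equiv.addLeft i₀) (Equiv.addLeft j₀))
      (cross_notMem_extremePoints (by rw [sum_comp_sumMap, hb]) fun i j => ?_)
    simpa using h (i₀ + i) (j₀ + j)
  · exact h c

/-- Mermin's parity contradiction: a deterministic diagonal already forces zeros off the diagonal.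
-/
theorem not_forall_abs_eq_one {b : MerminTriangle → ZMod 2} {e : Fin 3 × Fin 3 → ℝ}
    (he : e ∈ expectationPolytope b) (hb : ∑ σ, b σ = 1) : ¬ ∀ c, |e c| = 1 := by
  intro h
  have := diagonal_eq_zero he hb (fun i => h (i, i)) (i := 0) (j := 1) (by decide)
  simpa [this] using h (0, 1)

theorem perm_eq_zero {b : MerminTriangle → ZMod 2} {e : Fin 3 × Fin 3 → ℝ}
    (he : e ∈ expectationPolytope b) (hb : ∑ σ, b σ = 1) (π : Equiv.Perm (Fin 3))
    (hD : ∀ i, |e (i, π i)| = 1) {i j : Fin 3} (hij : j ≠ π i) : e (i, j) = 0 := by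
  have := diagonal_eq_zero (comp_prodMap_mem he (Equiv.refl _) π)
    (by rw [sum_comp_sumMap, hb]) (fun i => by simpa using hD i) (i := i) (j := π.symm j)
    (fun h => hij (by rw [h]; simp))
  simpa using this

/-- A point which is the only one with its deterministic values is extreme. -/
theorem mem_extremePoints_of_unique {b : MerminTriangle → ZMod 2} {e : Fin 3 × Fin 3 → ℝ}
    (he : e ∈ expectationPolytope b)
    (huniq : ∀ f ∈ expectationPolytope b, (∀ c, |e c| = 1 → f c = e c) → f = e) :
    e ∈ (expectationPolytope b).extremePoints ℝ := by
  have habs : ∀ f ∈ expectationPolytope b, ∀ c, |f c| ≤ 1 := fun f hf c =>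
    (hf (.inl c.1)).abs_le_one c.2
  -- The points ±1 are extreme in `[-1, 1]`, so both endpoints of a segment through `e` share its
  -- deterministic values.
  have key : ∀ x y z s t : ℝ, |x| ≤ 1 → |y| ≤ 1 → 0 < s → 0 < t → s + t = 1 →
      s * x + t * y = z → |z| = 1 → x = z ∧ y = z := by
    intro x y z s t hx hy hs ht hst hz hz1
    rw [abs_le] at hx hy
    have h2 : t = 1 - s := by linarith
    rcases eq_or_eq_neg_of_abs_eq hz1 with h | h
    · have hx1 : x = 1 := by nlinarith
      have hy1 : y = 1 := by nlinarith
      exact ⟨hx1.trans h.symm, hy1.trans h.symm⟩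
    · have hx1 : x = -1 := by nlinarith
      have hy1 : y = -1 := by nlinarith
      exact ⟨hx1.trans h.symm, hy1.trans h.symm⟩
  refine mem_extremePoints.2 ⟨he, fun x hx y hy ⟨s, t, hs, ht, hst, hxy⟩ => ?_⟩
  have h := fun c hc => key (x c) (y c) (e c) s t (habs x hx c) (habs y hy c) hs ht hst
    (congrFun hxy c) hc
  exact ⟨huniq x hx fun c hc => (h c hc).1, huniq y hy fun c hc => (h c hc).2⟩

/-! ### Expectations of finitely supported distributions -/

/-- The expectation of a function with respect to a finitely supported distribution. -/
noncomputable def expect {U : Type*} (p : StdSimplex ℝ U) (F : U → ℝ) : ℝ :=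
  p.weights.sum fun u w => w * F u

theorem expect_map {U V : Type*} (g : U → V) (p : StdSimplex ℝ U) (F : V → ℝ) :
    expect (p.map g) F = expect p (F ∘ g) := by
  unfold expect
  rw [StdSimplex.weights_map, Finsupp.sum_mapDomain_index (by simp) (by intros; ring)]
  rfl

theorem expect_single {U : Type*} (u : U) (F : U → ℝ) :
    expect (StdSimplex.single u) F = F u := by
  simp [expect]

theorem expect_eq_sum {U : Type*} [Fintype U] (p : StdSimplex ℝ U) (F : U → ℝ) :
    expect p F = ∑ u, p.weights u * F u :=
  Finsupp.sum_fintype _ _ (by simp)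

theorem sum_weights {U : Type*} [Fintype U] (p : StdSimplex ℝ U) : ∑ u, p.weights u = 1 := by
  rw [← p.total]
  exact (Finsupp.sum_fintype p.weights (fun _ r => r) fun _ => rfl).symm

/-- A distribution on `A × Y` that projects to `δ^y` is concentrated on `A × {y}`. -/
theorem eq_map_of_map_snd {A Y : Type*} {P : StdSimplex ℝ (A × Y)} {y : Y}
    (h : P.map Prod.snd = StdSimplex.single y) :
    P = (P.map Prod.fst).map fun a => (a, y) := by
  have hsupp : ∀ u ∈ P.weights.support, u.2 = y := by
    intro u hu
    by_contra hne
    classical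
    let F : Y → ℝ := fun z => if z = y then 0 else 1
    have hF : ∀ z, 0 ≤ F z := fun z => by simp only [F]; split_ifs <;> norm_num
    have h0 := expect_map Prod.snd P F
    rw [h, expect_single, show F y = 0 from if_pos rfl] at h0
    have h1 := (Finset.sum_eq_zero_iff_of_nonneg fun v _ =>
      mul_nonneg (P.nonneg v) (hF v.2)).1 h0.symm u hu
    simp only [F, if_neg hne, mul_one] at h1
    exact (Finsupp.mem_support_iff.1 hu) h1
  rw [StdSimplex.map_map]
  ext1
  rw [StdSimplex.weights_map]
  conv_lhs => rw [← Finsupp.mapDomain_id (v := P.weights)]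
  exact Finsupp.mapDomain_congr fun u hu => Prod.ext rfl (hsupp u hu)

theorem eq_of_map_snd {A Y : Type*} {P Q : StdSimplex ℝ (A × Y)} {y : Y}
    (hP : P.map Prod.snd = StdSimplex.single y) (hQ : Q.map Prod.snd = StdSimplex.single y)
    (h : P.map Prod.fst = Q.map Prod.fst) : P = Q := by
  rw [eq_map_of_map_snd hP, eq_map_of_map_snd hQ, h]

theorem weights_eq_of_map_snd {A Y : Type*} {P : StdSimplex ℝ (A × Y)} {y : Y}
    (hP : P.map Prod.snd = StdSimplex.single y) (a : A) :
    P.weights (a, y) = (P.map Prod.fst).weights a := by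
  conv_lhs => rw [eq_map_of_map_snd hP]
  rw [StdSimplex.weights_map]
  exact Finsupp.mapDomain_apply (f := fun a => (a, y)) (fun _ _ h => (Prod.ext_iff.1 h).1) _ a

theorem weights_eq_zero_of_map_snd {A Y : Type*} {P : StdSimplex ℝ (A × Y)} {y : Y}
    (hP : P.map Prod.snd = StdSimplex.single y) {u : A × Y} (hu : u.2 ≠ y) :
    P.weights u = 0 := by
  rw [eq_map_of_map_snd hP, StdSimplex.weights_map]
  refine Finsupp.mapDomain_of_notMem_range _ _ ?_
  rintro ⟨a, rfl⟩
  exact hu rfl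

/-! ### One and two bits -/

theorem sum_zmod_two {M : Type*} [AddCommMonoid M] (g : ZMod 2 → M) :
    ∑ t, g t = g 0 + g 1 :=
  Fin.sum_univ_two g

theorem sum_one_bit {M : Type*} [AddCommMonoid M] (g : (Fin 1 → ZMod 2) → M) :
    ∑ a, g a = g (fun _ => 0) + g (fun _ => 1) := by
  rw [← (Equiv.funUnique (Fin 1) (ZMod 2)).symm.sum_comp, sum_zmod_two]
  rfl

theorem sum_two_bits {M : Type*} [AddCommMonoid M] (g : (Fin 2 → ZMod 2) → M) :
    ∑ a, g a = g ![0, 0] + g ![0, 1] + (g ![1, 0] + g ![1, 1]) := by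
  rw [← (finTwoArrowEquiv (ZMod 2)).symm.sum_comp, Fintype.sum_prod_type, sum_zmod_two,
    sum_zmod_two, sum_zmod_two]
  rfl

theorem expect_one_bit (q : StdSimplex ℝ (Fin 1 → ZMod 2)) :
    expect q (fun a => sgn (a 0)) = q.weights (fun _ => 0) - q.weights (fun _ => 1) := by
  rw [expect_eq_sum, sum_one_bit]
  simp [sub_eq_add_neg]

theorem eq_of_expect_one_bit {q q' : StdSimplex ℝ (Fin 1 → ZMod 2)}
    (h : expect q (fun a => sgn (a 0)) = expect q' (fun a => sgn (a 0))) : q = q' := by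
  rw [expect_one_bit, expect_one_bit] at h
  have h1 := sum_weights q
  have h2 := sum_weights q'
  rw [sum_one_bit] at h1 h2
  have h3 : ∀ a : Fin 1 → ZMod 2, a = (fun _ => 0) ∨ a = fun _ => 1 := by decide
  ext a
  rcases h3 a with rfl | rfl <;> linarith

/-- The outcomes on the three faces of a triangle `σ` with `β(σ) = t`. -/
def faceBit (t : ZMod 2) (a : Fin 2 → ZMod 2) : Fin 3 → ZMod 2 :=
  ![a 1 + t, a 0 + a 1, a 0]

theorem sum_faceBit (t : ZMod 2) (a : Fin 2 → ZMod 2) : ∑ k, faceBit t a k = t := by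
  have h : ∀ t x y : ZMod 2, y + t + (x + y) + x = t := by decide
  rw [Fin.sum_univ_three]
  exact h t (a 0) (a 1)

theorem exists_faceBit {t : ZMod 2} {s : Fin 3 → ZMod 2} (hs : ∑ k, s k = t) :
    ∃ a, faceBit t a = s := by
  have h : ∀ x y z : ZMod 2, y + z + (x + y + z) = x ∧ z + (y + z) = y := by decide
  refine ⟨![s 2, s 1 + s 2], ?_⟩
  rw [← hs, Fin.sum_univ_three]
  funext k
  fin_cases k
  · exact (h _ _ _).1
  · exact (h (s 0) _ _).2
  · rfl

/-- Distinct outcomes have face bits of the same parity, so they differ on exactly two faces and the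
three signs sum to -1. -/
theorem one_add_sum_sgn (t : ZMod 2) (a a' : Fin 2 → ZMod 2) :
    1 + ∑ k, sgn (faceBit t a k) * sgn (faceBit t a' k) = if a' = a then 4 else 0 := by
  have h3 : ∀ a : Fin 2 → ZMod 2, a = ![0, 0] ∨ a = ![0, 1] ∨ a = ![1, 0] ∨ a = ![1, 1] := by
    decide
  have h2 : (1 + 1 : ZMod 2) = 0 := rfl
  rw [Fin.sum_univ_three]
  rcases zmod_two_cases t with rfl | rfl <;> rcases h3 a with rfl | rfl | rfl | rfl <;>
    rcases h3 a' with rfl | rfl | rfl | rfl <;> simp [faceBit, h2] <;> norm_num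

/-- Fourier inversion: the facet inequalities of the tetrahedron say that the four probabilities are
nonnegative. -/
theorem one_add_sum_expect (t : ZMod 2) (q : StdSimplex ℝ (Fin 2 → ZMod 2))
    (a : Fin 2 → ZMod 2) :
    1 + ∑ k, sgn (faceBit t a k) * expect q (fun a' => sgn (faceBit t a' k)) =
      4 * q.weights a := by
  have : ∑ a', q.weights a' * (1 + ∑ k, sgn (faceBit t a k) * sgn (faceBit t a' k)) =
      4 * q.weights a := by
    simp only [one_add_sum_sgn, mul_ite, mul_zero, Finset.sum_ite_eq', Finset.mem_univ, if_true]
    ring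
  rw [← this]
  simp only [mul_add, mul_one, Finset.sum_add_distrib, sum_weights, expect_eq_sum, Finset.mul_sum]
  rw [Finset.sum_comm]
  congr 1
  exact Finset.sum_congr rfl fun _ _ => Finset.sum_congr rfl fun _ _ => by ring

theorem eq_of_expect_two_bits (t : ZMod 2) {q q' : StdSimplex ℝ (Fin 2 → ZMod 2)}
    (h : ∀ k, expect q (fun a => sgn (faceBit t a k)) =
      expect q' (fun a => sgn (faceBit t a k))) : q = q' := by
  ext a
  have h1 := one_add_sum_expect t q a
  have h2 := one_add_sum_expect t q' a
  simp only [h] at h1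
  linarith

theorem tetrahedron_expect (t : ZMod 2) (q : StdSimplex ℝ (Fin 2 → ZMod 2)) :
    Tetrahedron t fun k => expect q fun a => sgn (faceBit t a k) := by
  intro s hs
  obtain ⟨a, rfl⟩ := exists_faceBit hs
  rw [one_add_sum_expect]
  exact mul_nonneg (by norm_num) (q.nonneg a)

/-- The distribution of two bits with given expectations on the three faces. -/
noncomputable def twoBitDist {t : ZMod 2} {f : Fin 3 → ℝ} (h : Tetrahedron t f) :
    StdSimplex ℝ (Fin 2 → ZMod 2) where
  weights := Finsupp.equivFunOnFinite.symm fun a => (1 + ∑ k, sgn (faceBit t a k) * f k) / 4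
  nonneg a := div_nonneg (h _ (sum_faceBit t a)) (by norm_num)
  total := by
    rw [Finsupp.sum_fintype _ _ (by simp), sum_two_bits]
    simp only [Finsupp.equivFunOnFinite_symm_apply_apply, Fin.sum_univ_three]
    rcases zmod_two_cases t with rfl | rfl <;>
      simp [faceBit, show (1 + 1 : ZMod 2) = 0 from rfl] <;> ring

theorem expect_twoBitDist {t : ZMod 2} {f : Fin 3 → ℝ} (h : Tetrahedron t f) (k : Fin 3) :
    expect (twoBitDist h) (fun a => sgn (faceBit t a k)) = f k := by
  rw [expect_eq_sum, sum_two_bits]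
  simp only [twoBitDist, Finsupp.equivFunOnFinite_symm_apply_apply, Fin.sum_univ_three]
  rcases zmod_two_cases t with rfl | rfl <;> fin_cases k <;>
    simp [faceBit, show (1 + 1 : ZMod 2) = 0 from rfl] <;> ring

/-! ### Faces in the twisted product -/

/-- The structure map of the twisted product. -/
def twistMap {X : SSet.{0}} (β : NormalizedCocycle X) {m n : ℕ} (θ : ⦋m⦌ ⟶ ⦋n⦌)
    (u : (Fin n → ZMod 2) × X _⦋n⦌) : (Fin m → ZMod 2) × X _⦋m⦌ :=
  (twistAct β θ u.1 u.2, X.map θ.op u.2)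

theorem twistMap_comp {X : SSet.{0}} (β : NormalizedCocycle X) {l m n : ℕ} (η : ⦋l⦌ ⟶ ⦋m⦌)
    (θ : ⦋m⦌ ⟶ ⦋n⦌) : twistMap β (η ≫ θ) = twistMap β η ∘ twistMap β θ :=
  funext fun u => ConcreteCategory.congr_hom ((twistedProduct β).map_comp θ.op η.op) u

theorem twistMap_δ {X : SSet.{0}} (β : NormalizedCocycle X) (k : Fin 3)
    (a : Fin 2 → ZMod 2) (x : X _⦋2⦌) :
    twistMap β (SimplexCategory.δ k : ⦋1⦌ ⟶ ⦋2⦌) (a, x) =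
      (fun _ => faceBit (β.val x) a k, X.δ k x) := by
  refine Prod.ext (funext fun i => ?_) rfl
  obtain rfl : i = 0 := Subsingleton.elim _ _
  change twistAct β (SimplexCategory.δ k) a x 0 = _
  have hface : β.face x 0 1 2 (by decide) (by decide) = β.val x := by
    have : (SimplexCategory.mkOfLeComp 0 1 2 (by decide) (by decide) : ⦋2⦌ ⟶ ⦋2⦌) = 𝟙 _ := by
      ext t : 3
      fin_cases t <;> rfl
    unfold NormalizedCocycle.face
    rw [this, op_id, X.map_id_apply]
  have h0 : ∀ j, β.face x 0 0 j le_rfl (Fin.zero_le _) = 0 := fun j => β.face_self_left x 0 j _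
  have h1 : β.face x 0 1 1 (by decide) le_rfl = 0 := β.face_self x 0 1 _
  fin_cases k
  · change (∑ j : Fin 2, if (1 : Fin 3) ≤ j.castSucc ∧ j.castSucc < 2 then a j else 0) +
      (β.face x 0 1 2 (by decide) (by decide) - β.face x 0 1 1 (by decide) le_rfl) = _
    rw [hface, h1]
    simp [Fin.sum_univ_two, faceBit]
  · change (∑ j : Fin 2, if (0 : Fin 3) ≤ j.castSucc ∧ j.castSucc < 2 then a j else 0) +
      (β.face x 0 0 2 le_rfl (by decide) - β.face x 0 0 0 le_rfl le_rfl) = _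
    rw [h0, h0]
    simp [Fin.sum_univ_two, faceBit]
  · change (∑ j : Fin 2, if (0 : Fin 3) ≤ j.castSucc ∧ j.castSucc < 1 then a j else 0) +
      (β.face x 0 0 1 le_rfl (by decide) - β.face x 0 0 0 le_rfl le_rfl) = _
    rw [h0, h0]
    simp [faceBit]

/-! ### Edge expectations of twisted distributions -/

namespace TwistedDist

section General

variable {X : SSet.{0}} {β : NormalizedCocycle X}

theorem at_map (p : TwistedDist β) {m n : ℕ} (θ : ⦋m⦌ ⟶ ⦋n⦌) (x : X _⦋n⦌) :
    p.at (X.map θ.op x) = (p.at x).map (twistMap β θ) :=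
  ConcreteCategory.congr_hom (p.1.naturality θ.op) x

theorem map_snd_at (p : TwistedDist β) {n : ℕ} (x : X _⦋n⦌) :
    (p.at x).map Prod.snd = StdSimplex.single x :=
  ConcreteCategory.congr_hom (NatTrans.congr_app p.2 (op ⦋n⦌)) x

theorem ext_at {p q : TwistedDist β} (h : ∀ (n : ℕ) (x : X _⦋n⦌), p.at x = q.at x) : p = q := by
  refine Subtype.ext (NatTrans.ext (funext fun n => ?_))
  refine ConcreteCategory.hom_ext _ _ fun x => ?_
  exact h n.unop.len x

theorem IsDeltaAt.map {p : TwistedDist β} {m n : ℕ} {x : X _⦋n⦌} {a : Fin n → ZMod 2}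
    (h : p.IsDeltaAt x a) (θ : ⦋m⦌ ⟶ ⦋n⦌) :
    p.IsDeltaAt (X.map θ.op x) (twistMap β θ (a, x)).1 := by
  unfold IsDeltaAt at h ⊢
  rw [at_map, h, StdSimplex.map_single]
  rfl

/-- The expectation of `(-1)^a` for the outcome `a` of an edge. -/
noncomputable def edgeExpect (p : TwistedDist β) (x : X _⦋1⦌) : ℝ :=
  expect ((p.at x).map Prod.fst) fun a => sgn (a 0)

theorem expect_map_fst_map_δ {P : StdSimplex ℝ ((Fin 2 → ZMod 2) × X _⦋2⦌)} {x : X _⦋2⦌}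
    (hP : P.map Prod.snd = StdSimplex.single x) (k : Fin 3) :
    expect ((P.map (twistMap β (SimplexCategory.δ k : ⦋1⦌ ⟶ ⦋2⦌))).map Prod.fst) (fun a => sgn (a 0)) =
      expect (P.map Prod.fst) fun a => sgn (faceBit (β.val x) a k) := by
  conv_lhs => rw [eq_map_of_map_snd hP]
  rw [StdSimplex.map_map, StdSimplex.map_map]
  simp only [twistMap_δ]
  rw [expect_map]
  rfl

theorem edgeExpect_δ (p : TwistedDist β) (x : X _⦋2⦌) (k : Fin 3) :
    p.edgeExpect (X.δ k x) =
      expect ((p.at x).map Prod.fst) fun a => sgn (faceBit (β.val x) a k) := by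
  have h := p.at_map (SimplexCategory.δ k) x
  rw [← expect_map_fst_map_δ (p.map_snd_at x) k, edgeExpect]
  congr 2

theorem edgeExpect_eq_sub (p : TwistedDist β) (x : X _⦋1⦌) :
    p.edgeExpect x = (p.at x).weights (fun _ => 0, x) - (p.at x).weights (fun _ => 1, x) := by
  rw [edgeExpect, expect_one_bit, weights_eq_of_map_snd (p.map_snd_at x),
    weights_eq_of_map_snd (p.map_snd_at x)]

theorem eq_of_edgeExpect {P Q : StdSimplex ℝ ((Fin 1 → ZMod 2) × X _⦋1⦌)} {x : X _⦋1⦌}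
    (hP : P.map Prod.snd = StdSimplex.single x) (hQ : Q.map Prod.snd = StdSimplex.single x)
    (h : expect (P.map Prod.fst) (fun a => sgn (a 0)) =
      expect (Q.map Prod.fst) fun a => sgn (a 0)) : P = Q :=
  eq_of_map_snd hP hQ (eq_of_expect_one_bit h)

theorem isDeltaAt_edge_iff (p : TwistedDist β) (x : X _⦋1⦌) (a : Fin 1 → ZMod 2) :
    p.IsDeltaAt x a ↔ p.edgeExpect x = sgn (a 0) := by
  have hs : expect ((StdSimplex.single (R := ℝ) (a, x)).map Prod.fst) (fun a => sgn (a 0)) =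
      sgn (a 0) := by
    rw [StdSimplex.map_single, expect_single]
  constructor
  · intro h
    rw [edgeExpect, h, hs]
  · intro h
    exact eq_of_edgeExpect (p.map_snd_at x) (StdSimplex.map_single _ _) (h.trans hs.symm)

theorem isDeltaAt_triangle_iff (p : TwistedDist β) (x : X _⦋2⦌) (a : Fin 2 → ZMod 2) :
    p.IsDeltaAt x a ↔ ∀ k : Fin 3, p.edgeExpect (X.δ k x) = sgn (faceBit (β.val x) a k) := by
  have hs : ∀ k, expect ((StdSimplex.single (R := ℝ) (a, x)).map Prod.fst)
      (fun a => sgn (faceBit (β.val x) a k)) = sgn (faceBit (β.val x) a k) := fun k => by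
    rw [StdSimplex.map_single, expect_single]
  simp only [edgeExpect_δ]
  constructor
  · intro h k
    rw [show p.at x = _ from h, hs]
  · intro h
    exact eq_of_map_snd (p.map_snd_at x) (StdSimplex.map_single _ _)
      (eq_of_expect_two_bits (β.val x) fun k => (h k).trans (hs k).symm)

theorem exists_isDeltaAt_edge_iff (p : TwistedDist β) (x : X _⦋1⦌) :
    (∃ a, p.IsDeltaAt x a) ↔ |p.edgeExpect x| = 1 := by
  simp only [isDeltaAt_edge_iff]
  constructor
  · rintro ⟨a, h⟩
    rw [h, abs_sgn]
  · intro h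
    obtain ⟨t, ht⟩ := exists_sgn_of_abs_eq_one h
    exact ⟨fun _ => t, ht⟩

theorem tetrahedron_edgeExpect (p : TwistedDist β) (x : X _⦋2⦌) :
    Tetrahedron (β.val x) fun k => p.edgeExpect (X.δ k x) := by
  simp only [edgeExpect_δ]
  exact tetrahedron_expect _ _

theorem exists_isDeltaAt_triangle_iff (p : TwistedDist β) (x : X _⦋2⦌) :
    (∃ a, p.IsDeltaAt x a) ↔ ∀ k : Fin 3, |p.edgeExpect (X.δ k x)| = 1 := by
  simp only [isDeltaAt_triangle_iff]
  constructor
  · rintro ⟨a, h⟩ k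
    rw [h, abs_sgn]
  · intro h
    choose s hs using fun k => exists_sgn_of_abs_eq_one (h k)
    have hsum : ∑ k, s k = β.val x := by
      have := (p.tetrahedron_edgeExpect x).eq_of_eq_sgn (k := 0) (l := 1) (m := 2)
        (by decide) (by decide) (by decide) (hs 0)
      rw [hs, hs, ← sgn_add] at this
      have h1 := sgn_injective this
      have h2 : ∀ x y z t : ZMod 2, y = t + x + z → x + y + z = t := by decide
      rw [Fin.sum_univ_three]
      exact h2 _ _ _ _ h1
    obtain ⟨a, ha⟩ := exists_faceBit hsum
    exact ⟨a, fun k => by rw [ha, hs]⟩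

end General

end TwistedDist

/-! ### Twisted distributions on the Mermin torus from edge expectations -/

section MerminTorus

variable {β : NormalizedCocycle merminTorus}

/-- The values of a cocycle on the six triangles. -/
def NormalizedCocycle.parity (β : NormalizedCocycle merminTorus) (σ : MerminTriangle) : ZMod 2 :=
  β.val (merminTri σ)

theorem merminFace_eq (σ : MerminTriangle) (k : Fin 3) :
    merminFace σ k = squareLine σ (Equiv.subRight (Sum.elim id id σ) k) := by
  rcases σ with i | i <;> rfl

/-- The simplicial numbering of the faces is a cyclic shift of the numbering by position, and the
tetrahedron is symmetric in its coordinates. -/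
theorem mem_expectationPolytope_iff {b : MerminTriangle → ZMod 2} {e : Fin 3 × Fin 3 → ℝ} :
    e ∈ expectationPolytope b ↔ ∀ σ, Tetrahedron (b σ) fun k => e (merminFace σ k) := by
  refine forall_congr' fun σ => ⟨fun h => ?_, fun h => ?_⟩
  · simp only [merminFace_eq]
    exact h.comp_perm (Equiv.subRight _)
  · have := h.comp_perm (Equiv.subRight (Sum.elim id id σ)).symm
    simpa only [merminFace_eq, Function.comp_def, Equiv.apply_symm_apply] using this

/-- The distribution on the triangle `σ` with given edge expectations. -/
noncomputable def triangleDist {e : Fin 3 × Fin 3 → ℝ} (he : e ∈ expectationPolytope β.parity)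
    (σ : MerminTriangle) : StdSimplex ℝ ((Fin 2 → ZMod 2) × merminTorus _⦋2⦌) :=
  (twoBitDist (mem_expectationPolytope_iff.1 he σ)).map fun a => (a, merminTri σ)

theorem map_snd_triangleDist {e : Fin 3 × Fin 3 → ℝ} (he : e ∈ expectationPolytope β.parity)
    (σ : MerminTriangle) :
    (triangleDist he σ).map Prod.snd = StdSimplex.single (merminTri σ) := by
  rw [triangleDist, StdSimplex.map_map, StdSimplex.map_const]

theorem map_fst_triangleDist {e : Fin 3 × Fin 3 → ℝ} (he : e ∈ expectationPolytope β.parity)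
    (σ : MerminTriangle) :
    (triangleDist he σ).map Prod.fst = twoBitDist (mem_expectationPolytope_iff.1 he σ) := by
  rw [triangleDist, StdSimplex.map_map]
  exact StdSimplex.map_id _

/-- The restriction of `triangleDist` along `θ`. -/
noncomputable def simplexDist {e : Fin 3 × Fin 3 → ℝ} (he : e ∈ expectationPolytope β.parity)
    (σ : MerminTriangle) {n : ℕ} (θ : ⦋n⦌ ⟶ ⦋2⦌) :
    StdSimplex ℝ ((Fin n → ZMod 2) × merminTorus _⦋n⦌) :=
  (triangleDist he σ).map (twistMap β θ)

theorem simplexDist_comp {e : Fin 3 × Fin 3 → ℝ} (he : e ∈ expectationPolytope β.parity)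
    (σ : MerminTriangle) {m n : ℕ} (η : ⦋m⦌ ⟶ ⦋n⦌) (θ : ⦋n⦌ ⟶ ⦋2⦌) :
    simplexDist he σ (η ≫ θ) = (simplexDist he σ θ).map (twistMap β η) := by
  unfold simplexDist
  rw [twistMap_comp, StdSimplex.map_comp]

theorem map_snd_simplexDist {e : Fin 3 × Fin 3 → ℝ} (he : e ∈ expectationPolytope β.parity)
    (σ : MerminTriangle) {n : ℕ} (θ : ⦋n⦌ ⟶ ⦋2⦌) :
    (simplexDist he σ θ).map Prod.snd =
      StdSimplex.single (merminTorus.map θ.op (merminTri σ)) := by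
  have h := StdSimplex.map_map (triangleDist he σ) Prod.snd (merminTorus.map θ.op)
  rw [map_snd_triangleDist, StdSimplex.map_single] at h
  rw [h]
  exact StdSimplex.map_map _ _ _

theorem expect_simplexDist_δ {e : Fin 3 × Fin 3 → ℝ} (he : e ∈ expectationPolytope β.parity)
    (σ : MerminTriangle) (k : Fin 3) :
    expect ((simplexDist he σ (SimplexCategory.δ k : ⦋1⦌ ⟶ ⦋2⦌)).map Prod.fst) (fun a => sgn (a 0)) = e (merminFace σ k) := by
  refine (TwistedDist.expect_map_fst_map_δ (map_snd_triangleDist he σ) k).trans ?_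
  rw [map_fst_triangleDist]
  exact expect_twoBitDist (mem_expectationPolytope_iff.1 he σ) k

/-- Compatibility with the gluing: a simplex in a shared edge is restricted from that edge, whose
one-bit distribution is fixed by its expectation; over a vertex there is only one distribution. -/
theorem simplexDist_congr {e : Fin 3 × Fin 3 → ℝ} (he : e ∈ expectationPolytope β.parity)
    {σ τ : MerminTriangle} {n : ℕ} (θ : ⦋n⦌ ⟶ ⦋2⦌)
    (h : σ = τ ∨ (∃ k, (∀ t, θ.toOrderHom t ≠ k) ∧ merminFace σ k = merminFace τ k) ∨
      ∃ v, ∀ t, θ.toOrderHom t = v) : simplexDist he σ θ = simplexDist he τ θ := by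
  rcases h with rfl | ⟨k, hk, hface⟩ | ⟨v, hv⟩
  · rfl
  · obtain ⟨η, rfl⟩ := SimplexCategory.eq_comp_δ_of_not_surjective' θ k hk
    rw [simplexDist_comp, simplexDist_comp]
    congr 1
    refine TwistedDist.eq_of_edgeExpect (x := merminEdge (merminFace σ k)) ?_ ?_ ?_
    · exact (map_snd_simplexDist he σ _).trans (congrArg _ (δ_merminTri σ k))
    · exact (map_snd_simplexDist he τ _).trans (congrArg _ ((δ_merminTri τ k).trans (by rw [hface])))
    · rw [expect_simplexDist_δ, expect_simplexDist_δ, hface]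
  · have hfac : θ = SimplexCategory.const ⦋n⦌ ⦋0⦌ 0 ≫ SimplexCategory.const ⦋0⦌ ⦋2⦌ v := by
      ext t : 3
      exact hv t
    rw [hfac, simplexDist_comp, simplexDist_comp]
    congr 1
    refine eq_of_map_snd (A := Fin 0 → ZMod 2) (y := merminTorus.map
      (SimplexCategory.const ⦋0⦌ ⦋2⦌ v).op (merminTri σ)) (map_snd_simplexDist he σ _) ?_ ?_
    · refine (map_snd_simplexDist he τ _).trans (congrArg _ ?_)
      exact subsingleton_merminTorus_zero_map _ ⟨v, fun _ => rfl⟩ _ _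
    · rw [Subsingleton.elim (Prod.fst : (Fin 0 → ZMod 2) × merminTorus _⦋0⦌ → _)
        (fun _ => 0)]
      exact (StdSimplex.map_const _ _).trans (StdSimplex.map_const _ _).symm

/-- The twisted distribution with given edge expectations. -/
noncomputable def ofExpectation {e : Fin 3 × Fin 3 → ℝ} (he : e ∈ expectationPolytope β.parity) :
    TwistedDist β where
  val :=
    { app n := TypeCat.ofHom fun x : Quotient (merminSetoid n.unop.len) =>
        (Quotient.lift (fun a : MerminTriangle × (Fin (n.unop.len + 1) →o Fin 3) =>
            simplexDist he a.1 (SimplexCategory.Hom.mk a.2 : ⦋n.unop.len⦌ ⟶ ⦋2⦌)) (by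
          rintro ⟨σ, α⟩ ⟨τ, α'⟩ ⟨rfl : α = α', h⟩
          exact simplexDist_congr he _ h) x : StdSimplex ℝ ((twistedProduct β).obj n))
      naturality n m θ := by
        refine ConcreteCategory.hom_ext _ _ fun x => ?_
        induction x using Quotient.inductionOn with
        | h a => exact simplexDist_comp he a.1 (m := m.unop.len) (n := n.unop.len) θ.unop (SimplexCategory.Hom.mk a.2) }
  property := by
    refine NatTrans.ext (funext fun n => ConcreteCategory.hom_ext _ _ fun x => ?_)
    induction x using Quotient.inductionOn with
    | h a => exact map_snd_simplexDist he a.1 (SimplexCategory.Hom.mk a.2)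

namespace TwistedDist

/-- The nine edge expectations. -/
noncomputable def expectation (p : TwistedDist β) (c : Fin 3 × Fin 3) : ℝ :=
  p.edgeExpect (merminEdge c)

theorem edgeExpect_δ_merminTri (p : TwistedDist β) (σ : MerminTriangle) (k : Fin 3) :
    p.edgeExpect (merminTorus.δ k (merminTri σ)) = p.expectation (merminFace σ k) := by
  rw [δ_merminTri, expectation]

theorem expectation_mem (p : TwistedDist β) : p.expectation ∈ expectationPolytope β.parity := by
  refine mem_expectationPolytope_iff.2 fun σ => ?_
  simp only [← edgeExpect_δ_merminTri]
  exact p.tetrahedron_edgeExpect _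

theorem expectation_ofExpectation {e : Fin 3 × Fin 3 → ℝ}
    (he : e ∈ expectationPolytope β.parity) : (ofExpectation he).expectation = e := by
  funext c
  have h := expect_simplexDist_δ he (.inl c.1) (c.1 + c.2)
  have h2 : merminFace (.inl c.1) (c.1 + c.2) = c := by simp [merminFace]
  rw [h2] at h
  exact h

theorem expectation_injective : Function.Injective (expectation (β := β)) := by
  intro p q h
  refine ext_at fun n x => ?_
  obtain ⟨σ, θ, rfl⟩ := exists_map_merminTri x
  rw [at_map p θ, at_map q θ]
  congr 1
  refine eq_of_map_snd (p.map_snd_at _) (q.map_snd_at _)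
    (eq_of_expect_two_bits (β.val (merminTri σ)) fun k => ?_)
  rw [← edgeExpect_δ, ← edgeExpect_δ, edgeExpect_δ_merminTri, edgeExpect_δ_merminTri, h]

theorem expectation_of_coords {p q r : TwistedDist β} {s t : ℝ}
    (h : s • q.coords + t • r.coords = p.coords) :
    s • q.expectation + t • r.expectation = p.expectation := by
  funext c
  have h' : ∀ a, s * (q.at (merminEdge c)).weights a + t * (r.at (merminEdge c)).weights a =
      (p.at (merminEdge c)).weights a := fun a =>
    congrFun (congrFun (congrFun h 1) (merminEdge c)) a
  simp only [Pi.add_apply, Pi.smul_apply, smul_eq_mul, expectation, edgeExpect_eq_sub, ← h']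
  ring

/-- The weights on a triangle are affine in the expectations, with constant term 1/4 (hence `hst`),
and all other weights are push-forwards of these, which is linear. -/
theorem coords_of_expectation {p q r : TwistedDist β} {s t : ℝ} (hst : s + t = 1)
    (h : s • q.expectation + t • r.expectation = p.expectation) :
    s • q.coords + t • r.coords = p.coords := by
  have htri : ∀ σ, s • (q.at (merminTri σ)).weights + t • (r.at (merminTri σ)).weights =
      (p.at (merminTri σ)).weights := by
    intro σ
    ext ⟨a, y⟩
    simp only [Finsupp.add_apply, Finsupp.smul_apply, smul_eq_mul]
    by_cases hy : y = merminTri σ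
    · subst hy
      rw [weights_eq_of_map_snd (p.map_snd_at _), weights_eq_of_map_snd (q.map_snd_at _),
        weights_eq_of_map_snd (r.map_snd_at _)]
      have key := fun u : TwistedDist β =>
        one_add_sum_expect (β.val (merminTri σ)) ((u.at (merminTri σ)).map Prod.fst) a
      simp only [← edgeExpect_δ, edgeExpect_δ_merminTri] at key
      have h1 := key p
      simp only [← h, Pi.add_apply, Pi.smul_apply, smul_eq_mul, Fin.sum_univ_three] at h1
      have h2 := key q
      have h3 := key r
      rw [Fin.sum_univ_three] at h2 h3
      linear_combination (-1 / 4 * s) * h2 + (-1 / 4 * t) * h3 + (1 / 4) * h1 +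
        (1 / 4) * hst
    · rw [weights_eq_zero_of_map_snd (p.map_snd_at _) hy,
        weights_eq_zero_of_map_snd (q.map_snd_at _) hy,
        weights_eq_zero_of_map_snd (r.map_snd_at _) hy]
      ring
  funext n x
  obtain ⟨σ, θ, rfl⟩ := exists_map_merminTri x
  funext a
  simp only [Pi.add_apply, Pi.smul_apply, smul_eq_mul, coords]
  rw [at_map p θ, at_map q θ, at_map r θ, StdSimplex.weights_map, StdSimplex.weights_map,
    StdSimplex.weights_map, ← htri, Finsupp.mapDomain_add, Finsupp.mapDomain_smul,
    Finsupp.mapDomain_smul]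
  rfl

theorem isVertex_iff (p : TwistedDist β) :
    p.IsVertex ↔ p.expectation ∈ (expectationPolytope β.parity).extremePoints ℝ := by
  unfold IsVertex
  rw [mem_extremePoints, mem_extremePoints]
  constructor
  · rintro ⟨-, h⟩
    refine ⟨p.expectation_mem, fun x hx y hy ⟨s, t, hs, ht, hst, hxy⟩ => ?_⟩
    rw [← expectation_ofExpectation hx, ← expectation_ofExpectation hy] at hxy
    have h' := h _ ⟨ofExpectation hx, rfl⟩ _ ⟨ofExpectation hy, rfl⟩
      ⟨s, t, hs, ht, hst, coords_of_expectation hst hxy⟩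
    have key : ∀ q : TwistedDist β, q.coords = p.coords → q.expectation = p.expectation :=
      fun q hq => by
        have := expectation_of_coords (p := p) (q := q) (r := q) (s := 1) (t := 0) (by simp [hq])
        simpa using this
    rw [← expectation_ofExpectation hx, ← expectation_ofExpectation hy]
    exact ⟨key _ h'.1, key _ h'.2⟩
  · rintro ⟨-, h⟩
    refine ⟨⟨p, rfl⟩, ?_⟩
    rintro _ ⟨q, rfl⟩ _ ⟨r, rfl⟩ ⟨s, t, hs, ht, hst, hqr⟩
    have h' := h _ q.expectation_mem _ r.expectation_mem
      ⟨s, t, hs, ht, hst, expectation_of_coords hqr⟩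
    exact ⟨congrArg _ (expectation_injective h'.1), congrArg _ (expectation_injective h'.2)⟩

end TwistedDist

end MerminTorus

/-! ### Classes of cocycles on the Mermin torus -/

theorem coboundary_one_apply {X : SSet.{0}} (s : X _⦋1⦌ → ZMod 2) (x : X _⦋2⦌) :
    coboundary X 1 s x = ∑ k : Fin 3, s (X.δ k x) := by
  change ∑ k : Fin 3, (-1 : ZMod 2) ^ (k : ℕ) * s (X.δ k x) = _
  simp only [show (-1 : ZMod 2) = 1 from rfl, one_pow, one_mul]

theorem sum_merminFace {M : Type*} [AddCommMonoid M] (σ : MerminTriangle)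
    (g : Fin 3 × Fin 3 → M) : ∑ k, g (merminFace σ k) = ∑ k, g (squareLine σ k) := by
  simp only [merminFace_eq]
  exact Equiv.sum_comp (Equiv.subRight _) fun k => g (squareLine σ k)

theorem coboundary_merminTri (s : merminTorus _⦋1⦌ → ZMod 2) (σ : MerminTriangle) :
    coboundary merminTorus 1 s (merminTri σ) = ∑ k, s (merminEdge (squareLine σ k)) := by
  rw [coboundary_one_apply, ← sum_merminFace σ fun c => s (merminEdge c)]
  simp only [δ_merminTri]

/-- Every cell is counted twice, once in its row and once in its column. -/
theorem sum_parity_eq_zero_of_coboundary {β : NormalizedCocycle merminTorus}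
    {s : merminTorus _⦋1⦌ → ZMod 2} (hs : coboundary merminTorus 1 s = β.val) :
    ∑ σ, β.parity σ = 0 := by
  unfold NormalizedCocycle.parity
  simp only [← hs, coboundary_merminTri, Fintype.sum_sum_type, squareLine, Sum.elim_inl,
    Sum.elim_inr]
  rw [Finset.sum_comm]
  exact (by decide : ∀ x : ZMod 2, x + x = 0) _

theorem NormalizedCocycle.cls_eq_zero_iff {X : SSet.{0}} (β : NormalizedCocycle X) :
    β.cls = 0 ↔ ∃ s, coboundary X 1 s = β.val := by
  refine (Submodule.Quotient.mk_eq_zero _).trans ?_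
  simp

/-- The faces of a degenerate triangle are one edge taken twice and a degenerate edge. -/
theorem coboundary_eq_zero_of_degenerate {X : SSet.{0}} {s : X _⦋1⦌ → ZMod 2}
    (hs : ∀ x ∈ X.degenerate 1, s x = 0) {x : X _⦋2⦌} (hx : x ∈ X.degenerate 2) :
    coboundary X 1 s x = 0 := by
  rw [SSet.degenerate_eq_iUnion_range_σ] at hx
  obtain ⟨i, y, rfl⟩ := Set.mem_iUnion.1 hx
  have h2 : ∀ a : ZMod 2, a + a = 0 := by decide
  rw [coboundary_one_apply, Fin.sum_univ_three]
  fin_cases i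
  · have h0 : X.δ 0 (X.σ 0 y) = y := SSet.δ_comp_σ_self_apply (i := 0) y
    have h1 : X.δ 1 (X.σ 0 y) = y := SSet.δ_comp_σ_succ_apply (i := 0) y
    have h3 : X.δ 2 (X.σ 0 y) = X.σ 0 (X.δ 1 y) :=
      SSet.δ_comp_σ_of_gt_apply (i := 1) (j := 0) (by decide) y
    change s (X.δ 0 (X.σ 0 y)) + s (X.δ 1 (X.σ 0 y)) + s (X.δ 2 (X.σ 0 y)) = 0
    rw [h0, h1, h3, hs _ (X.σ_mem_degenerate _ _), h2, add_zero]
  · have h0 : X.δ 0 (X.σ 1 y) = X.σ 0 (X.δ 0 y) :=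
      SSet.δ_comp_σ_of_le_apply (i := 0) (j := 0) (by decide) y
    have h1 : X.δ 1 (X.σ 1 y) = y := SSet.δ_comp_σ_self_apply (i := 1) y
    have h3 : X.δ 2 (X.σ 1 y) = y := SSet.δ_comp_σ_succ_apply (i := 1) y
    change s (X.δ 0 (X.σ 1 y)) + s (X.δ 1 (X.σ 1 y)) + s (X.δ 2 (X.σ 1 y)) = 0
    rw [h0, h1, h3, hs _ (X.σ_mem_degenerate _ _), zero_add, h2]

/-- The three faces of the doubly degenerate triangle coincide, and `3 = 1` modulo 2. -/
theorem eq_zero_of_degenerate_of_coboundary {X : SSet.{0}} {s : X _⦋1⦌ → ZMod 2} (v : X _⦋0⦌)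
    (h : coboundary X 1 s (X.σ 0 (X.σ 0 v)) = 0) : s (X.σ 0 v) = 0 := by
  have h0 : X.δ 0 (X.σ 0 (X.σ 0 v)) = X.σ 0 v := SSet.δ_comp_σ_self_apply (i := 0) _
  have h1 : X.δ 1 (X.σ 0 (X.σ 0 v)) = X.σ 0 v := SSet.δ_comp_σ_succ_apply (i := 0) _
  have h2 : X.δ 2 (X.σ 0 (X.σ 0 v)) = X.σ 0 (X.δ 1 (X.σ 0 v)) :=
    SSet.δ_comp_σ_of_gt_apply (i := 1) (j := 0) (by decide) _
  have h3 : X.δ 1 (X.σ 0 v) = v := SSet.δ_comp_σ_succ_apply (i := 0) v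
  rw [coboundary_one_apply, Fin.sum_univ_three, h0, h1, h2, h3] at h
  generalize s (X.σ 0 v) = t at h ⊢
  revert t; decide

theorem exists_sum_squareLine {b : MerminTriangle → ZMod 2} (hb : ∑ σ, b σ = 0) :
    ∃ g : Fin 3 × Fin 3 → ZMod 2, ∀ σ, ∑ k, g (squareLine σ k) = b σ := by
  -- Rows and columns 1 and 2 are served by the border cells and row 0 by the corner; column 0 is
  -- then correct because the total is 0.
  let m : Fin 3 → Fin 3 → ZMod 2 := ![![b (.inl 0) + b (.inr 1) + b (.inr 2), b (.inr 1), b (.inr 2)],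
    ![b (.inl 1), 0, 0], ![b (.inl 2), 0, 0]]
  have h2 : ∀ a : ZMod 2, a + a = 0 := by decide
  rw [Fintype.sum_sum_type, Fin.sum_univ_three, Fin.sum_univ_three] at hb
  refine ⟨fun c => m c.1 c.2, ?_⟩
  rintro (i | i) <;> fin_cases i <;> simp [Fin.sum_univ_three, squareLine, m]
  · linear_combination h2 (b (.inr 1)) + h2 (b (.inr 2))
  · linear_combination hb - h2 (b (.inr 0))

theorem cls_eq_zero_of_sum_parity {β : NormalizedCocycle merminTorus}
    (hb : ∑ σ, β.parity σ = 0) : β.cls = 0 := by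
  classical
  obtain ⟨g, hg⟩ := exists_sum_squareLine hb
  -- The value 0 on degenerate edges matches the normalization of `β` on degenerate triangles.
  let s : merminTorus _⦋1⦌ → ZMod 2 := fun x =>
    if h : ∃ c, merminEdge c = x then g h.choose else 0
  have hs : ∀ c, s (merminEdge c) = g c := fun c => by
    have h : ∃ c', merminEdge c' = merminEdge c := ⟨c, rfl⟩
    simp only [s, dif_pos h]
    rw [merminEdge_injective h.choose_spec]
  refine β.cls_eq_zero_iff.2 ⟨s, funext fun x => ?_⟩
  by_cases hx : x ∈ merminTorus.degenerate 2
  · rw [β.normalized x hx]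
    refine coboundary_eq_zero_of_degenerate (fun y hy => dif_neg ?_) hx
    rintro ⟨c, rfl⟩
    exact merminEdge_mem_nonDegenerate c hy
  · obtain ⟨σ, rfl⟩ := exists_merminTri_of_nonDegenerate hx
    rw [coboundary_merminTri]
    simp only [hs]
    exact hg σ

theorem sum_parity_eq_one {β : NormalizedCocycle merminTorus} (h : β.cls ≠ 0) :
    ∑ σ, β.parity σ = 1 :=
  (zmod_two_cases _).resolve_left fun h0 => h (cls_eq_zero_of_sum_parity h0)

/-! ### Deterministic simplices -/

namespace TwistedDist

section General

variable {X : SSet.{0}} {β : NormalizedCocycle X}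

/-- The simplices `x` for which `p_x` is a delta distribution. -/
def deltaSubcomplex (p : TwistedDist β) : X.Subcomplex where
  obj n := {x | ∃ a : Fin n.unop.len → ZMod 2, p.IsDeltaAt (n := n.unop.len) x a}
  map {n m} θ := by
    rintro x ⟨a, ha⟩
    exact ⟨_, ha.map (m := m.unop.len) (n := n.unop.len) θ.unop⟩

theorem detSubset_le_deltaSubcomplex (p : TwistedDist β) : p.detSubset ≤ p.deltaSubcomplex := by
  refine sup_le (iSup₂_le fun x hx => ?_) (iSup₂_le fun x hx => ?_)
  · exact (SSet.Subcomplex.ofSimplex_le_iff x _).2 hx.2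
  · exact (SSet.Subcomplex.ofSimplex_le_iff x _).2 hx.2

theorem isDeltaAt_vertex (p : TwistedDist β) (v : X _⦋0⦌) : p.IsDeltaAt v 0 := by
  refine eq_of_map_snd (p.map_snd_at v) (StdSimplex.map_single _ _) ?_
  rw [Subsingleton.elim (Prod.fst : (Fin 0 → ZMod 2) × X _⦋0⦌ → _) (fun _ => 0),
    StdSimplex.map_const, StdSimplex.map_const]

theorem isDeltaAt_degenerate (p : TwistedDist β) (v : X _⦋0⦌) :
    p.IsDeltaAt (X.σ 0 v) (fun _ => 0) := by
  have h := (p.isDeltaAt_vertex v).map (SimplexCategory.σ 0 : ⦋1⦌ ⟶ ⦋0⦌)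
  have h0 : (twistMap β (SimplexCategory.σ 0 : ⦋1⦌ ⟶ ⦋0⦌) (0, v)).1 = fun _ => 0 := by
    funext k
    obtain rfl : k = 0 := Subsingleton.elim (α := Fin 1) _ _
    change (∑ j : Fin 0, _) + (β.face v 0 0 0 le_rfl le_rfl - β.face v 0 0 0 le_rfl le_rfl) = 0
    simp
  rwa [h0] at h

/-- Since a delta distribution determines its point, naturality of `p` makes the pointwise outcomes
a simplicial section. -/
theorem isDeterministic_iff (p : TwistedDist β) :
    p.IsDeterministic ↔ p.deltaSubcomplex = ⊤ := by
  have hinj : ∀ {U : Type} {u v : U}, (StdSimplex.single (R := ℝ) u) = StdSimplex.single v →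
      u = v := fun h =>
    Finsupp.single_left_injective one_ne_zero (congrArg StdSimplex.weights h)
  constructor
  · rintro ⟨s, hs, hp⟩
    refine top_unique fun n x _ => ?_
    have h1 : (s.app n x).2 = x :=
      (ConcreteCategory.congr_hom (NatTrans.congr_app hs n) x : (s ≫ twistedProj β).app n x = x)
    refine ⟨(s.app n x).1, ?_⟩
    have h2 : p.1.app n x = StdSimplex.single (s.app n x) :=
      ConcreteCategory.congr_hom (NatTrans.congr_app hp n) x
    refine h2.trans ?_
    exact congrArg _ (Prod.ext rfl h1)
  · intro h
    have hmem : ∀ (n : SimplexCategoryᵒᵖ) (x : X.obj n),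
        ∃ a : Fin n.unop.len → ZMod 2, p.IsDeltaAt (n := n.unop.len) x a := fun n x => by
      have : x ∈ p.deltaSubcomplex.obj n := by rw [h]; trivial
      exact this
    choose a ha using hmem
    refine ⟨{ app := fun n => TypeCat.ofHom fun x => (a n x, x)
              naturality := fun n m θ => ConcreteCategory.hom_ext _ _ fun x => ?_ }, rfl, ?_⟩
    · exact hinj ((ha m (X.map θ x)).symm.trans
        ((ha n x).map (m := m.unop.len) (n := n.unop.len) θ.unop))
    · refine NatTrans.ext (funext fun n => ConcreteCategory.hom_ext _ _ fun x => ?_)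
      exact ha n x

end General

variable {β : NormalizedCocycle merminTorus}

theorem merminEdge_mem_deltaSubcomplex_iff (p : TwistedDist β) (c : Fin 3 × Fin 3) :
    merminEdge c ∈ p.deltaSubcomplex.obj (op ⦋1⦌) ↔ |p.expectation c| = 1 :=
  p.exists_isDeltaAt_edge_iff (merminEdge c)

theorem merminTri_mem_deltaSubcomplex_iff (p : TwistedDist β) (σ : MerminTriangle) :
    merminTri σ ∈ p.deltaSubcomplex.obj (op ⦋2⦌) ↔ ∀ k, |p.expectation (squareLine σ k)| = 1 := by
  refine (p.exists_isDeltaAt_triangle_iff (merminTri σ)).trans ?_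
  simp only [edgeExpect_δ_merminTri, merminFace_eq]
  exact (Equiv.subRight _).forall_congr_right (q := fun k => |p.expectation (squareLine σ k)| = 1)

theorem isDeterministic_iff_abs (p : TwistedDist β) :
    p.IsDeterministic ↔ ∀ c, |p.expectation c| = 1 := by
  rw [isDeterministic_iff]
  constructor
  · intro h c
    rw [← merminEdge_mem_deltaSubcomplex_iff, h]
    trivial
  · intro h
    refine top_unique fun n x _ => ?_
    obtain ⟨σ, θ, rfl⟩ := exists_map_merminTri x
    exact p.deltaSubcomplex.map θ.op ((p.merminTri_mem_deltaSubcomplex_iff σ).2 fun k => h _)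

theorem detSubset_le_iff (p : TwistedDist β) (Z : merminTorus.Subcomplex) :
    p.detSubset ≤ Z ↔
      (∀ c, |p.expectation c| = 1 → merminEdge c ∈ Z.obj (op ⦋1⦌)) ∧
        ∀ σ, (∀ k, |p.expectation (squareLine σ k)| = 1) → merminTri σ ∈ Z.obj (op ⦋2⦌) := by
  unfold detSubset
  simp only [sup_le_iff, iSup_le_iff, SSet.Subcomplex.ofSimplex_le_iff]
  refine and_congr ⟨fun h c hc => ?_, fun h x hx => ?_⟩ ⟨fun h σ hσ => ?_, fun h x hx => ?_⟩
  · exact h _ ⟨merminEdge_mem_nonDegenerate c, (p.merminEdge_mem_deltaSubcomplex_iff c).2 hc⟩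
  · obtain ⟨c, rfl⟩ := exists_merminEdge_of_nonDegenerate hx.1
    exact h c ((p.merminEdge_mem_deltaSubcomplex_iff c).1 hx.2)
  · exact h _ ⟨merminTri_mem_nonDegenerate σ, (p.merminTri_mem_deltaSubcomplex_iff σ).2 hσ⟩
  · obtain ⟨σ, rfl⟩ := exists_merminTri_of_nonDegenerate hx.1
    exact h σ ((p.merminTri_mem_deltaSubcomplex_iff σ).1 hx.2)

/-- Delta simplices are closed under faces, so generating a subcomplex adds no edge that is not
deterministic. -/
theorem merminEdge_mem_detSubset_iff (p : TwistedDist β) (c : Fin 3 × Fin 3) :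
    merminEdge c ∈ p.detSubset.obj (op ⦋1⦌) ↔ |p.expectation c| = 1 :=
  ⟨fun h => (p.merminEdge_mem_deltaSubcomplex_iff c).1 (p.detSubset_le_deltaSubcomplex _ h),
    ((p.detSubset_le_iff _).1 le_rfl).1 c⟩

end TwistedDist

/-! ### The two kinds of generating sets -/

theorem exists_merminFace_inl_iff (i : Fin 3) (c : Fin 3 × Fin 3) :
    (∃ k, merminFace (.inl i) k = c) ↔ c.1 = i := by
  constructor
  · rintro ⟨k, rfl⟩; rfl
  · rintro rfl; exact ⟨c.1 + c.2, by simp [merminFace]⟩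

theorem exists_merminFace_inr_iff (j : Fin 3) (c : Fin 3 × Fin 3) :
    (∃ k, merminFace (.inr j) k = c) ↔ c.2 = j := by
  constructor
  · rintro ⟨k, rfl⟩; rfl
  · rintro rfl; exact ⟨c.1 + c.2, by simp [merminFace]⟩

/-- The subcomplex generated by the edges on the graph of a permutation. -/
def permSubcomplex (π : Equiv.Perm (Fin 3)) : merminTorus.Subcomplex :=
  ⨆ i, SSet.Subcomplex.ofSimplex (merminEdge (i, π i))

/-- The subcomplex generated by the triangles of a row and a column. -/
def crossSubcomplex (i j : Fin 3) : merminTorus.Subcomplex :=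
  SSet.Subcomplex.ofSimplex (merminTri (.inl i)) ⊔ SSet.Subcomplex.ofSimplex (merminTri (.inr j))

/-- Exactly one of the three cells in every row and in every column means that both coordinates are
bijective. -/
theorem isThreeEdges_iff (Z : merminTorus.Subcomplex) :
    IsThreeEdges Z ↔ ∃ π, Z = permSubcomplex π := by
  constructor
  · rintro ⟨x, -, hnd, hx, rfl⟩
    choose c hc using fun i => exists_merminEdge_of_nonDegenerate (hnd i)
    obtain rfl : x = fun i => merminEdge (c i) := funext fun i => (hc i).symm
    have h1 : Function.Bijective fun i => (c i).1 :=
      Function.bijective_iff_existsUnique _ |>.2 fun r => by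
        have := hx _ (merminTri_mem_nonDegenerate (.inl r))
        simpa only [merminEdge_mem_boundaryEdges_iff, exists_merminFace_inl_iff] using this
    have h2 : Function.Bijective fun i => (c i).2 :=
      Function.bijective_iff_existsUnique _ |>.2 fun r => by
        have := hx _ (merminTri_mem_nonDegenerate (.inr r))
        simpa only [merminEdge_mem_boundaryEdges_iff, exists_merminFace_inr_iff] using this
    let f := Equiv.ofBijective _ h1
    refine ⟨f.symm.trans (Equiv.ofBijective _ h2), ?_⟩
    refine Equiv.iSup_congr f fun i => ?_
    rw [Equiv.trans_apply, Equiv.symm_apply_apply]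
    rfl
  · rintro ⟨π, rfl⟩
    refine ⟨fun i => merminEdge (i, π i), fun i j h => (Prod.ext_iff.1 (merminEdge_injective h)).1,
      fun i => merminEdge_mem_nonDegenerate _, fun σ hσ => ?_, rfl⟩
    obtain ⟨σ, rfl⟩ := exists_merminTri_of_nonDegenerate hσ
    simp only [merminEdge_mem_boundaryEdges_iff]
    rcases σ with i | j
    · simp only [exists_merminFace_inl_iff]
      exact ⟨i, rfl, fun _ h => h⟩
    · simp only [exists_merminFace_inr_iff]
      exact ⟨π.symm j, π.apply_symm_apply j, fun i h => (π.symm_apply_eq.2 h.symm).symm⟩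

/-- Two different rows, or two different columns, share no cell. -/
theorem isTwoTriangles_iff (Z : merminTorus.Subcomplex) :
    IsTwoTriangles Z ↔ ∃ i j, Z = crossSubcomplex i j := by
  constructor
  · rintro ⟨σ, hσ, τ, hτ, hne, ⟨x, hx, hxσ, hxτ⟩, rfl⟩
    obtain ⟨σ, rfl⟩ := exists_merminTri_of_nonDegenerate hσ
    obtain ⟨τ, rfl⟩ := exists_merminTri_of_nonDegenerate hτ
    obtain ⟨c, rfl⟩ := exists_merminEdge_of_nonDegenerate hx
    rw [merminEdge_mem_boundaryEdges_iff] at hxσ hxτ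
    rcases σ with i | i <;> rcases τ with j | j <;>
      simp only [exists_merminFace_inl_iff, exists_merminFace_inr_iff] at hxσ hxτ
    · exact absurd (by rw [← hxσ, ← hxτ]) hne
    · exact ⟨i, j, rfl⟩
    · exact ⟨j, i, sup_comm _ _⟩
    · exact absurd (by rw [← hxσ, ← hxτ]) hne
  · rintro ⟨i, j, rfl⟩
    refine ⟨_, merminTri_mem_nonDegenerate _, _, merminTri_mem_nonDegenerate _,
      fun h => Sum.inl_ne_inr (merminTri_injective h), ⟨merminEdge (i, j),
        merminEdge_mem_nonDegenerate _, ?_, ?_⟩, rfl⟩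
    · rw [merminEdge_mem_boundaryEdges_iff, exists_merminFace_inl_iff]
    · rw [merminEdge_mem_boundaryEdges_iff, exists_merminFace_inr_iff]

theorem merminEdge_mem_permSubcomplex (π : Equiv.Perm (Fin 3)) (i : Fin 3) :
    merminEdge (i, π i) ∈ (permSubcomplex π).obj (op ⦋1⦌) :=
  (SSet.Subcomplex.ofSimplex_le_iff _ _).1
    (le_iSup (fun i => SSet.Subcomplex.ofSimplex (merminEdge (i, π i))) i)

theorem merminTri_inl_mem_crossSubcomplex (i j : Fin 3) :
    merminTri (.inl i) ∈ (crossSubcomplex i j).obj (op ⦋2⦌) :=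
  (SSet.Subcomplex.ofSimplex_le_iff _ _).1 le_sup_left

theorem merminTri_inr_mem_crossSubcomplex (i j : Fin 3) :
    merminTri (.inr j) ∈ (crossSubcomplex i j).obj (op ⦋2⦌) :=
  (SSet.Subcomplex.ofSimplex_le_iff _ _).1 le_sup_right

theorem merminEdge_mem_of_merminTri_mem {Z : merminTorus.Subcomplex} {σ : MerminTriangle}
    (h : merminTri σ ∈ Z.obj (op ⦋2⦌)) (k : Fin 3) :
    merminEdge (merminFace σ k) ∈ Z.obj (op ⦋1⦌) := by
  rw [← δ_merminTri]
  exact Z.map (SimplexCategory.δ k).op h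

theorem merminEdge_mem_crossSubcomplex {i₀ j₀ : Fin 3} {c : Fin 3 × Fin 3}
    (hc : c.1 = i₀ ∨ c.2 = j₀) : merminEdge c ∈ (crossSubcomplex i₀ j₀).obj (op ⦋1⦌) := by
  rcases hc with h | h
  · obtain ⟨k, rfl⟩ := (exists_merminFace_inl_iff i₀ c).2 h
    exact merminEdge_mem_of_merminTri_mem (merminTri_inl_mem_crossSubcomplex i₀ j₀) k
  · obtain ⟨k, rfl⟩ := (exists_merminFace_inr_iff j₀ c).2 h
    exact merminEdge_mem_of_merminTri_mem (merminTri_inr_mem_crossSubcomplex i₀ j₀) k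

/-! ### Deterministic subsets and vertices with prescribed outcomes -/

namespace TwistedDist

variable {β : NormalizedCocycle merminTorus}

theorem detSubset_eq_permSubcomplex {p : TwistedDist β} {π : Equiv.Perm (Fin 3)}
    (h : ∀ i j, |p.expectation (i, j)| = 1 ↔ j = π i) : p.detSubset = permSubcomplex π := by
  apply le_antisymm
  · refine (p.detSubset_le_iff _).2 ⟨fun ⟨i, j⟩ hc => ?_, fun σ hσ => ?_⟩
    · obtain rfl := (h i j).1 hc
      exact merminEdge_mem_permSubcomplex π i
    · exfalso
      rcases σ with i | j
      · have := ((h i 0).1 (hσ 0)).trans ((h i 1).1 (hσ 1)).symm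
        exact absurd this (by decide)
      · have := ((h 0 j).1 (hσ 0)).symm.trans ((h 1 j).1 (hσ 1))
        exact absurd (π.injective this) (by decide)
  · refine iSup_le fun i => (SSet.Subcomplex.ofSimplex_le_iff _ _).2 ?_
    exact (p.merminEdge_mem_detSubset_iff _).2 ((h _ _).2 rfl)

theorem detSubset_eq_crossSubcomplex {p : TwistedDist β} {i₀ j₀ : Fin 3}
    (h : ∀ i j, |p.expectation (i, j)| = 1 ↔ i = i₀ ∨ j = j₀) :
    p.detSubset = crossSubcomplex i₀ j₀ := by
  apply le_antisymm
  · refine (p.detSubset_le_iff _).2 ⟨fun ⟨i, j⟩ hc => ?_, fun σ hσ => ?_⟩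
    · exact merminEdge_mem_crossSubcomplex ((h i j).1 hc)
    · rcases σ with i | j
      · obtain ⟨k, hk, -⟩ := exists_third j₀ j₀
        obtain rfl := ((h i k).1 (hσ k)).resolve_right hk.symm
        exact merminTri_inl_mem_crossSubcomplex _ _
      · obtain ⟨k, hk, -⟩ := exists_third i₀ i₀
        obtain rfl := ((h k j).1 (hσ k)).resolve_left hk.symm
        exact merminTri_inr_mem_crossSubcomplex _ _
  · have hmem := ((p.detSubset_le_iff _).1 le_rfl).2
    refine sup_le ((SSet.Subcomplex.ofSimplex_le_iff _ _).2 (hmem _ fun k => ?_))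
      ((SSet.Subcomplex.ofSimplex_le_iff _ _).2 (hmem _ fun k => ?_))
    · exact (h _ _).2 (.inl rfl)
    · exact (h _ _).2 (.inr rfl)

/-- `p` is a vertex if its deterministic edges force all other expectations to vanish. -/
theorem isVertex_of_forces_zero {p : TwistedDist β} {C : Fin 3 × Fin 3 → Prop}
    (hC : ∀ e ∈ expectationPolytope β.parity, (∀ c, C c → |e c| = 1) → ∀ c, ¬ C c → e c = 0)
    (hp : ∀ c, C c → |p.expectation c| = 1) : p.IsVertex := by
  refine p.isVertex_iff.2 (mem_extremePoints_of_unique p.expectation_mem fun f hf h => ?_)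
  funext c
  by_cases hc : C c
  · exact h c (hp c hc)
  · rw [hC _ p.expectation_mem hp c hc]
    exact hC f hf (fun c hc => by rw [h c (hp c hc)]; exact hp c hc) c hc

/-- The vertex has expectation `sgn (s c)` on `C` and 0 elsewhere. Any other candidate has the same
values on `C` by its outcomes on `Z`, and `hC` makes it vanish off `C`. -/
theorem existsUnique_of_forces_zero (C : Fin 3 × Fin 3 → Prop) [DecidablePred C]
    (Z : merminTorus.Subcomplex) (s : merminTorus _⦋1⦌ → ZMod 2)
    (hs : ∀ σ ∈ Z.obj (op ⦋2⦌), coboundary merminTorus 1 s σ = β.val σ)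
    (hC : ∀ e ∈ expectationPolytope β.parity, (∀ c, C c → |e c| = 1) → ∀ c, ¬ C c → e c = 0)
    (hCs : (fun c => if C c then sgn (s (merminEdge c)) else 0) ∈ expectationPolytope β.parity)
    (hCZ : ∀ c, C c → merminEdge c ∈ Z.obj (op ⦋1⦌))
    (hZ : ∀ p : TwistedDist β, (∀ i j, |p.expectation (i, j)| = 1 ↔ C (i, j)) →
      p.detSubset = Z) :
    ∃! p : TwistedDist β, p.IsVertex ∧ p.detSubset = Z ∧
      ∀ x ∈ Z.obj (op ⦋1⦌), p.IsDeltaAt x fun _ => s x := by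
  have hexp := expectation_ofExpectation hCs
  have habs : ∀ c, |(ofExpectation hCs).expectation c| = 1 ↔ C c := fun c => by
    rw [hexp]
    by_cases hc : C c <;> simp [hc]
  have hdet := hZ (ofExpectation hCs) fun i j => habs (i, j)
  refine ⟨ofExpectation hCs, ⟨isVertex_of_forces_zero hC fun c => (habs c).2, hdet,
    fun x hx => ?_⟩, ?_⟩
  -- On a degenerate edge every distribution has outcome 0; `s` agrees because the doubly degenerate
  -- triangle also lies in `Z`.
  · by_cases hdeg : x ∈ merminTorus.degenerate 1
    · rw [SSet.degenerate_eq_iUnion_range_σ] at hdeg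
      obtain ⟨i, v, rfl⟩ := Set.mem_iUnion.1 hdeg
      obtain rfl : i = 0 := Subsingleton.elim (α := Fin 1) _ _
      have h0 : s (merminTorus.σ 0 v) = 0 := eq_zero_of_degenerate_of_coboundary v <| by
        exact (hs _ (Z.map (SimplexCategory.σ 0).op hx)).trans
          (β.normalized _ (merminTorus.σ_mem_degenerate _ _))
      rw [h0]
      exact isDeltaAt_degenerate _ v
    · obtain ⟨c, rfl⟩ := exists_merminEdge_of_nonDegenerate hdeg
      rw [← hdet, merminEdge_mem_detSubset_iff, habs] at hx
      rw [isDeltaAt_edge_iff]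
      exact (congrFun hexp c).trans (if_pos hx)
  · rintro q ⟨-, -, hq⟩
    apply expectation_injective
    rw [hexp]
    have hqC : ∀ c, C c → q.expectation c = sgn (s (merminEdge c)) := fun c hc =>
      (q.isDeltaAt_edge_iff _ _).1 (hq _ (hCZ c hc))
    funext c
    by_cases hc : C c
    · rw [if_pos hc, hqC c hc]
    · rw [if_neg hc]
      exact hC _ q.expectation_mem (fun c hc => by rw [hqC c hc, abs_sgn]) c hc

theorem perm_forces_zero (hb : ∑ σ, β.parity σ = 1) (π : Equiv.Perm (Fin 3)) :
    ∀ e ∈ expectationPolytope β.parity, (∀ c : Fin 3 × Fin 3, c.2 = π c.1 → |e c| = 1) →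
      ∀ c : Fin 3 × Fin 3, ¬ c.2 = π c.1 → e c = 0 :=
  fun _ he h _ hc => perm_eq_zero he hb π (fun i => h (i, π i) rfl) hc

theorem cross_forces_zero (hb : ∑ σ, β.parity σ = 1) (i₀ j₀ : Fin 3) :
    ∀ e ∈ expectationPolytope β.parity,
      (∀ c : Fin 3 × Fin 3, c.1 = i₀ ∨ c.2 = j₀ → |e c| = 1) →
      ∀ c : Fin 3 × Fin 3, ¬ (c.1 = i₀ ∨ c.2 = j₀) → e c = 0 :=
  fun _ he h _ hc => cross_eq_zero he hb (fun j => h (i₀, j) (.inl rfl))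
    (fun i => h (i, j₀) (.inr rfl)) (fun h => hc (.inl h.symm)) (fun h => hc (.inr h.symm))

end TwistedDist

/-! ### Membership of the prescribed expectations in the polytope -/

theorem tetrahedron_of_eq_zero (t : ZMod 2) {f : Fin 3 → ℝ} (k : Fin 3) (hk : |f k| ≤ 1)
    (h : ∀ l, l ≠ k → f l = 0) : Tetrahedron t f := by
  intro s _
  rw [Finset.sum_eq_single k (fun l _ hl => by rw [h l hl, mul_zero]) (by simp)]
  have : |sgn (s k) * f k| ≤ 1 := by rw [abs_mul, abs_sgn, one_mul]; exact hk
  linarith [(abs_le.1 this).1]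

theorem tetrahedron_sgn {t : ZMod 2} {s : Fin 3 → ZMod 2} (hs : ∑ k, s k = t) :
    Tetrahedron t fun k => sgn (s k) := by
  intro s' hs'
  obtain ⟨a, rfl⟩ := exists_faceBit hs
  obtain ⟨a', rfl⟩ := exists_faceBit hs'
  rw [one_add_sum_sgn]
  split_ifs <;> norm_num

theorem perm_mem_expectationPolytope (b : MerminTriangle → ZMod 2) (π : Equiv.Perm (Fin 3))
    (g : Fin 3 × Fin 3 → ZMod 2) :
    (fun c : Fin 3 × Fin 3 => if c.2 = π c.1 then sgn (g c) else 0) ∈ expectationPolytope b := by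
  rintro (i | j)
  · refine tetrahedron_of_eq_zero _ (π i) (by simp [squareLine]) fun l hl => ?_
    simp [squareLine, hl]
  · refine tetrahedron_of_eq_zero _ (π.symm j) (by simp [squareLine]) fun l hl => ?_
    have : j ≠ π l := fun h => hl (by rw [h]; simp)
    simp [squareLine, this]

theorem cross_mem_expectationPolytope {b : MerminTriangle → ZMod 2} {i₀ j₀ : Fin 3}
    {g : Fin 3 × Fin 3 → ZMod 2} (hr : ∑ k, g (i₀, k) = b (.inl i₀))
    (hc : ∑ k, g (k, j₀) = b (.inr j₀)) :
    (fun c : Fin 3 × Fin 3 => if c.1 = i₀ ∨ c.2 = j₀ then sgn (g c) else 0) ∈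
      expectationPolytope b := by
  rintro (i | j)
  · by_cases hi : i = i₀
    · subst hi
      simpa [squareLine] using tetrahedron_sgn hr
    · refine tetrahedron_of_eq_zero _ j₀ (by simp [squareLine]) fun l hl => ?_
      simp [squareLine, hi, hl]
  · by_cases hj : j = j₀
    · subst hj
      simpa [squareLine] using tetrahedron_sgn hc
    · refine tetrahedron_of_eq_zero _ i₀ (by simp [squareLine]) fun l hl => ?_
      simp [squareLine, hj, hl]

end SimplicialDistribution

/-! ### The classification of the vertices -/

open SimplicialDistribution Simplicial Opposite in
theorem mainTheorem8 (β : NormalizedCocycle merminTorus) :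
    (β.cls = 0 → ∀ p : TwistedDist β, p.IsVertex ↔ p.IsDeterministic) ∧
    (β.cls ≠ 0 →
      (∀ p : TwistedDist β,
        p.IsVertex ↔ IsThreeEdges p.detSubset ∨ IsTwoTriangles p.detSubset) ∧
      (∀ Z : merminTorus.Subcomplex, IsThreeEdges Z ∨ IsTwoTriangles Z →
        ∀ s : merminTorus _⦋1⦌ → ZMod 2,
          (∀ σ ∈ Z.obj (op ⦋2⦌), coboundary merminTorus 1 s σ = β.val σ) →
          ∃! p : TwistedDist β, p.IsVertex ∧ p.detSubset = Z ∧
            ∀ x ∈ Z.obj (op ⦋1⦌), p.IsDeltaAt x fun _ => s x)) := by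
  refine ⟨fun hcls p => ?_, fun hcls => ?_⟩
  · obtain ⟨s, hs⟩ := β.cls_eq_zero_iff.1 hcls
    rw [p.isDeterministic_iff_abs]
    refine ⟨fun h => abs_eq_one_of_mem_extremePoints (p.isVertex_iff.1 h)
      (sum_parity_eq_zero_of_coboundary hs), fun h => ?_⟩
    -- With all nine edges deterministic there is no expectation left to force.
    exact TwistedDist.isVertex_of_forces_zero (C := fun _ => True)
      (fun _ _ _ _ hc => absurd trivial hc) fun c _ => h c
  have hb := sum_parity_eq_one hcls
  simp only [isThreeEdges_iff, isTwoTriangles_iff]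
  refine ⟨fun p => ⟨fun h => ?_, ?_⟩, ?_⟩
  · rcases extremePoints_cases (p.isVertex_iff.1 h) with ⟨π, hπ⟩ | ⟨i, j, hij⟩ | hall
    · exact .inl ⟨π, TwistedDist.detSubset_eq_permSubcomplex hπ⟩
    · exact .inr ⟨i, j, TwistedDist.detSubset_eq_crossSubcomplex hij⟩
    · exact absurd hall (not_forall_abs_eq_one p.expectation_mem hb)
  · rintro (⟨π, hZ⟩ | ⟨i, j, hZ⟩)
    · refine TwistedDist.isVertex_of_forces_zero (TwistedDist.perm_forces_zero hb π) ?_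
      rintro ⟨i, j⟩ (rfl : j = π i)
      rw [← p.merminEdge_mem_detSubset_iff, hZ]
      exact merminEdge_mem_permSubcomplex π i
    · refine TwistedDist.isVertex_of_forces_zero (TwistedDist.cross_forces_zero hb i j) ?_
      intro c hc
      rw [← p.merminEdge_mem_detSubset_iff, hZ]
      exact merminEdge_mem_crossSubcomplex hc
  · rintro _ (⟨π, rfl⟩ | ⟨i, j, rfl⟩) s hs
    · refine TwistedDist.existsUnique_of_forces_zero _ _ s hs (TwistedDist.perm_forces_zero hb π)
        (perm_mem_expectationPolytope _ π fun c => s (merminEdge c)) ?_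
        fun p => TwistedDist.detSubset_eq_permSubcomplex
      rintro ⟨i, j⟩ (rfl : j = π i)
      exact merminEdge_mem_permSubcomplex π i
    · refine TwistedDist.existsUnique_of_forces_zero _ _ s hs
        (TwistedDist.cross_forces_zero hb i j)
        (cross_mem_expectationPolytope (g := fun c => s (merminEdge c)) ?_ ?_)
        (fun c => merminEdge_mem_crossSubcomplex)
        fun p => TwistedDist.detSubset_eq_crossSubcomplex
      · rw [NormalizedCocycle.parity, ← hs _ (merminTri_inl_mem_crossSubcomplex i j),
          coboundary_merminTri]
        rfl
      · rw [NormalizedCocycle.parity, ← hs _ (merminTri_inr_mem_crossSubcomplex i j),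
          coboundary_merminTri]
        rfl
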